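/- For $\alpha>0$ let $\mathcal C^\alpha$ be the space of continuous $f:[0,1]\to\mathbb R$ with $$\|f\|_\alpha:=\|f\|_\infty+\sup_{0\le s<t\le1}\frac{|f_t-f_s|}{|t-s|^\alpha}<\infty .$$ Integrals $\int_a^b g\,df$ against Hölder functions are Young integrals, i.e. limits of the Riemann sums $\sum_i g_{\xi_i}(f_{t_{i+1}}-f_{t_i})$ over tagged partitions of $[a,b]$ as the mesh tends to $0$. Let $\gamma,\kappa\in(0,1)$ with $\gamma+\kappa>1$, let $p\ge 1$ be real and $\varepsilon>\frac1{2p}$, and let $M>0$. Let $\varphi_M$ be $\mathcal C^\infty$ on $(0,\infty)$ with all derivatives bounded, $\varphi_M(r)=0$ for $r>M+1$ and $\varphi_M(r)=1$ for $r<M$ (in particular $\varphi_M(0)=1$). Put $$\|f\|_{\gamma,p}:=\Big(\int_0^1\!\!\int_0^1\frac{|f_\zeta-f_\eta|^{2p}}{|\zeta-\eta|^{2p\gamma+2}}\,d\zeta\,d\eta\Big)^{1/(2p)},\qquad G_M(f):=\varphi_M\big(\|f\|_{\gamma,p}^{2p}\big),\qquad \sigma_M(f,y):=G_M(f)\,\sigma(y),$$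 where $\sigma\in\mathcal C^4(\mathbb R)$ is bounded together with its derivatives up to order $4$. Let $x\in\mathcal C^{\gamma+\varepsilon}$ and, for $h\in\mathcal C^{\gamma+\varepsilon}$, $z\in\mathcal C^\kappa$, $t\in[0,1]$, set $$F(h,z)_t:=z_t-\int_0^t du\Big(\int_u^1\sigma_M(x+h,z_\xi)\,d(x+h)_\xi\Big)+t\int_0^1\xi\,\sigma_M(x+h,z_\xi)\,d(x+h)_\xi .$$ Then the following hold; all the integrals that occur exist. (a) $G_M:\mathcal C^{\gamma+\varepsilon}\to\mathbb R$ is well defined and Fréchet differentiable, and for $y,k\in\mathcal C^{\gamma+\varepsilon}$ $$DG_M(y)\cdot k=2p\,\varphi_M'\big(\|y\|_{\gamma,p}^{2p}\big)\int_0^1\!\!\int_0^1\frac{|y_\zeta-y_\eta|^{2p-2}(y_\zeta-y_\eta)(k_\zeta-k_\eta)}{|\zeta-\eta|^{2p\gamma+2}}\,d\zeta\,d\eta .$$ (b) $F$ maps $\mathcal C^{\gamma+\varepsilon}\times\mathcal C^\kappa$ into $\mathcal C^\kappa$, is (jointly) continuous, and is Fréchet differentiable with respect to the first variable and with respect to the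 second variable. For all $k\in\mathcal C^{\gamma+\varepsilon}$, $g\in\mathcal C^\kappa$, $t\in[0,1]$, $$\begin{aligned}(D_1F(h,z)\cdot k)_t=&-\int_0^t du\Big[\int_u^1\sigma_M(x+h,z_\xi)\,dk_\xi+\int_u^1(DG_M(x+h)\cdot k)\,\sigma(z_\xi)\,d(x+h)_\xi\Big]\\&+t\Big[\int_0^1\xi\,\sigma_M(x+h,z_\xi)\,dk_\xi+\int_0^1\xi\,(DG_M(x+h)\cdot k)\,\sigma(z_\xi)\,d(x+h)_\xi\Big],\end{aligned}$$ $$(D_2F(h,z)\cdot g)_t=g_t-\int_0^t du\Big[\int_u^1G_M(x+h)\,\sigma'(z_\xi)\,g_\xi\,d(x+h)_\xi\Big]+t\int_0^1\xi\,G_M(x+h)\,\sigma'(z_\xi)\,g_\xi\,d(x+h)_\xi .$$ -/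

import Mathlib

open Set MeasureTheory
open scoped NNReal ContDiff

noncomputable section

/-! ### Hölder spaces on `[0,1]` -/

/-- The continuous functions on `[0,1]` whose `γ`-Hölder seminorm is finite. -/
def holderSubmodule (γ : ℝ≥0) : Submodule ℝ C(unitInterval, ℝ) where
  carrier := {f | MemHolder γ f}
  add_mem' hf hg := by
    simpa only [mem_ofPred_eq, ContinuousMap.coe_add] using MemHolder.add hf hg
  zero_mem' := by
    simpa only [mem_ofPred_eq, ContinuousMap.coe_zero] using memHolder_zero
  smul_mem' c f hf := by
    simpa only [mem_ofPred_eq, ContinuousMap.coe_smul] using MemHolder.smul hf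

/-- The Hölder space `C^γ = C^γ([0,1])`. It is a separate type (not the coerced submodule), so that
it does not inherit the sup norm of `C(unitInterval, ℝ)`. -/
def HolderSpace (γ : ℝ≥0) : Type := holderSubmodule γ

namespace HolderSpace

variable {γ : ℝ≥0}

instance : AddCommGroup (HolderSpace γ) := inferInstanceAs (AddCommGroup (holderSubmodule γ))

instance : Module ℝ (HolderSpace γ) := inferInstanceAs (Module ℝ (holderSubmodule γ))

/-- The continuous function underlying an element of `C^γ`. -/
def toContinuousMap (f : HolderSpace γ) : C(unitInterval, ℝ) := Subtype.val f

instance : CoeFun (HolderSpace γ) (fun _ => unitInterval → ℝ) := ⟨fun f => f.toContinuousMap⟩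

theorem memHolder (f : HolderSpace γ) : MemHolder γ (f : unitInterval → ℝ) := Subtype.property f

/-- `‖f‖_γ = sup_t |f t| + sup_{s ≠ t} |f t - f s| / |t - s| ^ γ`. -/
instance : Norm (HolderSpace γ) := ⟨fun f => ‖f.toContinuousMap‖ + nnHolderNorm γ (f : unitInterval → ℝ)⟩

theorem norm_def (f : HolderSpace γ) :
    ‖f‖ = ‖f.toContinuousMap‖ + nnHolderNorm γ (f : unitInterval → ℝ) := rfl

theorem normedSpaceCore (γ : ℝ≥0) : NormedSpace.Core ℝ (HolderSpace γ) where
  norm_nonneg f := by rw [norm_def]; positivity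
  norm_smul c f := by
    have h1 : ‖(c • f).toContinuousMap‖ = ‖c‖ * ‖f.toContinuousMap‖ :=
      norm_smul c f.toContinuousMap
    have h2 : nnHolderNorm γ ((c • f : HolderSpace γ) : unitInterval → ℝ) =
        ‖c‖₊ * nnHolderNorm γ (f : unitInterval → ℝ) :=
      f.memHolder.nnHolderNorm_smul c
    rw [norm_def, norm_def, h1, h2, mul_add]
    rfl
  norm_triangle f g := by
    have h1 : ‖(f + g).toContinuousMap‖ ≤ ‖f.toContinuousMap‖ + ‖g.toContinuousMap‖ :=
      norm_add_le f.toContinuousMap g.toContinuousMap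
    have h2 : nnHolderNorm γ ((f + g : HolderSpace γ) : unitInterval → ℝ) ≤
        nnHolderNorm γ (f : unitInterval → ℝ) + nnHolderNorm γ (g : unitInterval → ℝ) :=
      f.memHolder.nnHolderNorm_add_le g.memHolder
    have h3 : (nnHolderNorm γ ((f + g : HolderSpace γ) : unitInterval → ℝ) : ℝ) ≤
        nnHolderNorm γ (f : unitInterval → ℝ) + nnHolderNorm γ (g : unitInterval → ℝ) := by exact_mod_cast h2
    simp only [norm_def]
    linarith
  norm_eq_zero_iff f := by
    constructor
    · intro h
      have h1 : ‖f.toContinuousMap‖ = 0 := by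
        have h2 := norm_def f
        have h3 := norm_nonneg f.toContinuousMap
        have h4 := NNReal.coe_nonneg (nnHolderNorm γ (f : unitInterval → ℝ))
        linarith
      exact Subtype.ext (norm_eq_zero.mp h1)
    · rintro rfl
      have h1 : ‖(0 : HolderSpace γ).toContinuousMap‖ = 0 := norm_zero (E := C(unitInterval, ℝ))
      have h2 : nnHolderNorm γ ((0 : HolderSpace γ) : unitInterval → ℝ) = 0 :=
        nnHolderNorm_zero _ γ
      rw [norm_def, h1, h2, NNReal.coe_zero, add_zero]

instance : NormedAddCommGroup (HolderSpace γ) := NormedAddCommGroup.ofCore (normedSpaceCore γ)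

instance : NormedSpace ℝ (HolderSpace γ) := NormedSpace.ofCore (normedSpaceCore γ)

end HolderSpace

/-! ### The Young integral -/

/-- `J` is the Young (Riemann–Stieltjes) integral `∫_a^b g df`: the limit of the Riemann sums
`∑ g (ξ i) * (f (t (i + 1)) - f (t i))` over tagged partitions `a = t 0 ≤ t 1 ≤ ⋯ ≤ t n = b`,
`t i ≤ ξ i ≤ t (i + 1)`, as the mesh tends to zero. -/
def HasYoungIntegral (g f : unitInterval → ℝ) (a b : unitInterval) (J : ℝ) : Prop :=
  a ≤ b ∧ ∀ η > 0, ∃ δ > 0, ∀ (n : ℕ) (t ξ : ℕ → unitInterval), t 0 = a → t n = b →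
    (∀ i < n, t i ≤ ξ i ∧ ξ i ≤ t (i + 1) ∧ (t (i + 1) : ℝ) - t i < δ) →
    |∑ i ∈ Finset.range n, g (ξ i) * (f (t (i + 1)) - f (t i)) - J| < η

/-- The Young integral is unique. -/
theorem HasYoungIntegral.unique {g f : unitInterval → ℝ} {a b : unitInterval} {J J' : ℝ}
    (h : HasYoungIntegral g f a b J) (h' : HasYoungIntegral g f a b J') : J = J' := by
  by_contra hne
  have hpos : 0 < |J - J'| / 2 := by
    have := abs_pos.mpr (sub_ne_zero.mpr hne)
    linarith
  obtain ⟨hab, h⟩ := h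
  obtain ⟨δ, hδ, H⟩ := h _ hpos
  obtain ⟨δ', hδ', H'⟩ := h'.2 _ hpos
  have hm : 0 < min δ δ' / 2 := by have := lt_min hδ hδ'; linarith
  set m := min δ δ' / 2 with hmdef
  obtain ⟨n, hn⟩ := exists_nat_gt (1 / m)
  let t : ℕ → unitInterval := fun i => projIcc 0 1 zero_le_one (min ((a : ℝ) + i * m) b)
  have hab' : (a : ℝ) ≤ b := hab
  have ht : ∀ i, (t i : ℝ) = min ((a : ℝ) + i * m) b := by
    intro i
    have h0 : 0 ≤ min ((a : ℝ) + i * m) b :=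
      le_min (add_nonneg a.2.1 (mul_nonneg (Nat.cast_nonneg _) hm.le)) b.2.1
    have h1 : min ((a : ℝ) + i * m) b ≤ 1 := (min_le_right _ _).trans b.2.2
    simp only [t, projIcc_of_mem zero_le_one ⟨h0, h1⟩]
  have t0 : t 0 = a := by
    apply Subtype.ext
    rw [ht]
    simp [hab']
  have tn : t n = b := by
    apply Subtype.ext
    rw [ht]
    apply min_eq_right
    have : 1 < n * m := (div_lt_iff₀ hm).mp hn
    linarith [b.2.2, a.2.1]
  have step : ∀ i, (t i : ℝ) ≤ t (i + 1) ∧ (t (i + 1) : ℝ) - t i ≤ m := by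
    intro i
    rw [ht, ht]
    push_cast
    constructor
    · apply min_le_min_right
      nlinarith
    · rcases le_total ((a : ℝ) + i * m) b with hc | hc
      · rw [min_eq_left hc]
        have := min_le_left ((a : ℝ) + (i + 1) * m) b
        linarith
      · rw [min_eq_right hc]
        have := min_le_right ((a : ℝ) + (i + 1) * m) b
        linarith
  have hmδ : m < δ := by have := min_le_left δ δ'; linarith
  have hmδ' : m < δ' := by have := min_le_right δ δ'; linarith
  have e1 := H n t t t0 tn fun i _ => ⟨le_rfl, (step i).1, (step i).2.trans_lt hmδ⟩
  have e2 := H' n t t t0 tn fun i _ => ⟨le_rfl, (step i).1, (step i).2.trans_lt hmδ'⟩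
  rw [abs_lt] at e1 e2
  rcases abs_cases (J - J') with hc | hc <;> linarith

/-- The Young integral `∫_a^b g df` exists. -/
def YoungIntegrable (g f : unitInterval → ℝ) (a b : unitInterval) : Prop := ∃ J, HasYoungIntegral g f a b J

open Classical in
/-- The Young integral `∫_a^b g df` (zero if it does not exist). -/
def youngIntegral (g f : unitInterval → ℝ) (a b : unitInterval) : ℝ :=
  if h : YoungIntegrable g f a b then h.choose else 0

theorem HasYoungIntegral.youngIntegral_eq {g f : unitInterval → ℝ} {a b : unitInterval} {J : ℝ}
    (h : HasYoungIntegral g f a b J) : youngIntegral g f a b = J := by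
  have h' : YoungIntegrable g f a b := ⟨J, h⟩
  rw [youngIntegral, dif_pos h']
  exact h'.choose_spec.unique h

/-! ### The cutoff -/

/-- `φ` is a cutoff function at level `M`: it is `C^∞` on `(0,∞)` with all derivatives bounded there,
equals `0` on `(M+1, ∞)` and `1` on `(-∞, M)`. The values on `(-∞, 0]` only fix the natural
extension by `1`, which is needed at `0`. -/
structure IsCutoff (M : ℝ) (φ : ℝ → ℝ) : Prop where
  contDiffOn : ContDiffOn ℝ ∞ φ (Ioi 0)
  bounded : ∀ n : ℕ, ∃ C : ℝ, ∀ r > 0, |iteratedDeriv n φ r| ≤ C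
  eq_zero : ∀ r, M + 1 < r → φ r = 0
  eq_one : ∀ r, r < M → φ r = 1

/-- The integrand `|f ζ - f η| ^ (2p) / |ζ - η| ^ (2pγ + 2)` on `[0,1]²`. -/
def sobolevIntegrand (γ p : ℝ) (f : unitInterval → ℝ) (q : unitInterval × unitInterval) : ℝ :=
  |f q.1 - f q.2| ^ (2 * p) / |(q.1 : ℝ) - q.2| ^ (2 * p * γ + 2)

/-- The Sobolev type norm `‖f‖_{γ,p}`. -/
def sobolevNorm (γ p : ℝ) (f : unitInterval → ℝ) : ℝ :=
  (∫ q : unitInterval × unitInterval, sobolevIntegrand γ p f q) ^ (1 / (2 * p))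

/-- `G_M(f) = φ_M (‖f‖_{γ,p} ^ (2p))`. -/
def cutoffG (φ : ℝ → ℝ) (γ p : ℝ) (f : unitInterval → ℝ) : ℝ := φ (sobolevNorm γ p f ^ (2 * p))

/-- `σ_M(x, y) = G_M(x) σ(y)`. -/
def cutoffSigma (φ : ℝ → ℝ) (γ p : ℝ) (σ : ℝ → ℝ) (x : unitInterval → ℝ) (y : ℝ) : ℝ :=
  cutoffG φ γ p x * σ y

/-- The integrand `(f ζ - f η) ^ (2p-1) * (k ζ - k η) / |ζ - η| ^ (2pγ + 2)` on `[0,1]²`, where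
`a ^ (2p-1)` is the odd power `|a| ^ (2p-2) * a`. -/
def sobolevDerivIntegrand (γ p : ℝ) (f k : unitInterval → ℝ) (q : unitInterval × unitInterval) : ℝ :=
  |f q.1 - f q.2| ^ (2 * p - 2) * (f q.1 - f q.2) * (k q.1 - k q.2) /
    |(q.1 : ℝ) - q.2| ^ (2 * p * γ + 2)

/-- `Γ_x(z)_t = ∫_0^t du (∫_u^1 σ_M(x, z_ξ) dx_ξ) - t ∫_0^1 ξ σ_M(x, z_ξ) dx_ξ`. -/
def ellipticMap (φ : ℝ → ℝ) (γ p : ℝ) (σ : ℝ → ℝ) (x z : unitInterval → ℝ) (t : unitInterval) : ℝ :=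
  (∫ u in Iic t, youngIntegral (fun ξ => cutoffSigma φ γ p σ x (z ξ)) x u 1) -
    t * youngIntegral (fun ξ => ξ * cutoffSigma φ γ p σ x (z ξ)) x 0 1

end

/-! ### Young integration of Hölder functions on the line -/

/-! The map splits as `F h z = z + G(x + h) • T (S z) (x + h)`. Here `G` is the scalar cutoff
`cutoffG`, `S z = σ ∘ z` is a superposition operator, and `T` is the drift `youngDrift` as a
function of integrand and driver. Since `G_M` does not depend on the integration variable, it leaves
the Young integrals as a factor. If `T` is bounded bilinear and `G`, `S` are Fréchet differentiable,
then continuity and both partial derivatives follow from the product and chain rules.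

Boundedness of `T` is the Young–Loève estimate. The dyadic Riemann sums converge geometrically
because `κ + γ > 1` (`exists_young_sewing`). The limit is additive over adjacent intervals and
equals `g s * (f t - f s)` up to `O(|t - s| ^ (κ + γ))`. Those two properties force convergence of
all tagged Riemann sums (`hasYoungIntegral_of_sewing`) and bound the integral by Hölder norms. The
outer `du` integral and the factor `t` make the result Lipschitz in `t`, hence `κ`-Hölder
(`exists_youngDrift_bilinear`).

Differentiability of `S` in the Hölder norm needs the Taylor remainder of `σ` to be quadratically
small both in sup norm and in its increments. The increments cost one more derivative
(`abs_taylorRemainder_sub_le`).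

For `G`, the second order expansion of `|a| ^ (2p)` is integrated against the Sobolev weight. For
functions in `C^{γ+ε}` what remains is the kernel `|ζ - η| ^ (2pε - 2)`, integrable on the square
exactly because `2pε > 1` (`integrable_div_abs_sub_rpow`). Composition with `φ` is harmless at `0`,
where `φ` is locally constant. -/

/-- The left Riemann–Stieltjes sum of `∫_s^t g df` over the dyadic partition of `[s, t]` into
`2 ^ n` pieces. -/
noncomputable def dyadicSum (g f : ℝ → ℝ) : ℕ → ℝ → ℝ → ℝ
  | 0, s, t => g s * (f t - f s)
  | n + 1, s, t => dyadicSum g f n s ((s + t) / 2) + dyadicSum g f n ((s + t) / 2) t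

/-- Source of the ratio `2 ^ (1 - θ)`: bisecting an interval turns one error of order `θ` into two
errors at half the length. -/
theorem two_mul_half_rpow {x : ℝ} (hx : 0 ≤ x) (θ : ℝ) :
    2 * (x / 2) ^ θ = x ^ θ * 2 ^ (1 - θ) := by
  rw [Real.div_rpow hx zero_le_two, Real.rpow_sub zero_lt_two, Real.rpow_one]
  field_simp

theorem two_rpow_one_sub_lt_one {θ : ℝ} (hθ : 1 < θ) : (2 : ℝ) ^ (1 - θ) < 1 :=
  Real.rpow_lt_one_of_one_lt_of_neg one_lt_two (by linarith)

theorem abs_half_sub_left (s t : ℝ) : |(s + t) / 2 - s| = |t - s| / 2 := by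
  rw [show (s + t) / 2 - s = (t - s) / 2 by ring, abs_div, abs_two]

theorem abs_sub_half (s t : ℝ) : |t - (s + t) / 2| = |t - s| / 2 := by
  rw [show t - (s + t) / 2 = (t - s) / 2 by ring, abs_div, abs_two]

/-- One bisection changes the sum by a product of an increment of `g` and one of `f`. Each further
level gains the factor `2 ^ (1 - (κ + γ))`, so the dyadic sums are Cauchy when `κ + γ > 1`. -/
theorem abs_dyadicSum_succ_sub_le {g f : ℝ → ℝ} {A B κ γ : ℝ} (hA : 0 ≤ A) (hB : 0 ≤ B)
    (hκ : 0 ≤ κ) (hγ : 0 ≤ γ)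
    (hg : ∀ s t, |g t - g s| ≤ A * |t - s| ^ κ) (hf : ∀ s t, |f t - f s| ≤ B * |t - s| ^ γ)
    (n : ℕ) (s t : ℝ) :
    |dyadicSum g f (n + 1) s t - dyadicSum g f n s t| ≤
      A * B * |t - s| ^ (κ + γ) * (2 ^ (1 - (κ + γ))) ^ n := by
  induction n generalizing s t with
  | zero =>
    simp only [dyadicSum, pow_zero, mul_one]
    rw [show g s * (f ((s + t) / 2) - f s) + g ((s + t) / 2) * (f t - f ((s + t) / 2)) -
      g s * (f t - f s) = (g ((s + t) / 2) - g s) * (f t - f ((s + t) / 2)) by ring, abs_mul]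
    have h1 : |g ((s + t) / 2) - g s| ≤ A * |t - s| ^ κ := by
      refine (hg _ _).trans ?_
      rw [abs_half_sub_left]
      gcongr
      linarith [abs_nonneg (t - s)]
    have h2 : |f t - f ((s + t) / 2)| ≤ B * |t - s| ^ γ := by
      refine (hf _ _).trans ?_
      rw [abs_sub_half]
      gcongr
      linarith [abs_nonneg (t - s)]
    calc _ ≤ (A * |t - s| ^ κ) * (B * |t - s| ^ γ) := by gcongr
      _ = _ := by rw [Real.rpow_add_of_nonneg (abs_nonneg _) hκ hγ]; ring
  | succ n ih =>
    have h1 := ih s ((s + t) / 2)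
    have h2 := ih ((s + t) / 2) t
    rw [abs_half_sub_left] at h1
    rw [abs_sub_half] at h2
    have h3 := two_mul_half_rpow (abs_nonneg (t - s)) (κ + γ)
    change |(dyadicSum g f (n + 1) s ((s + t) / 2) + dyadicSum g f (n + 1) ((s + t) / 2) t) -
      (dyadicSum g f n s ((s + t) / 2) + dyadicSum g f n ((s + t) / 2) t)| ≤ _
    rw [add_sub_add_comm]
    refine (abs_add_le _ _).trans ((add_le_add h1 h2).trans_eq ?_)
    rw [pow_succ]
    linear_combination (A * B * (2 ^ (1 - (κ + γ))) ^ n) * h3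

/-- Joint continuity passes to the dyadic limit and later extends additivity from rational to real
division points. -/
theorem continuous_dyadicSum {g f : ℝ → ℝ} (hg : Continuous g) (hf : Continuous f) (n : ℕ) :
    Continuous fun q : ℝ × ℝ => dyadicSum g f n q.1 q.2 := by
  induction n with
  | zero => simp only [dyadicSum]; fun_prop
  | succ n ih =>
    simp only [dyadicSum]
    exact (ih.comp (f := fun q : ℝ × ℝ => (q.1, (q.1 + q.2) / 2)) (by fun_prop)).add
      (ih.comp (f := fun q : ℝ × ℝ => ((q.1 + q.2) / 2, q.2)) (by fun_prop))

/-- A midpoint-additive function of intervals of order `|t - s| ^ θ`, `θ > 1`, vanishes. -/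
theorem eq_zero_of_midpoint_additive {D : ℝ → ℝ → ℝ} {C θ : ℝ} (hθ : 1 < θ)
    (hD : ∀ s t, D s t = D s ((s + t) / 2) + D ((s + t) / 2) t)
    (hC : ∀ s t, |D s t| ≤ C * |t - s| ^ θ) (s t : ℝ) : D s t = 0 := by
  have key : ∀ (n : ℕ) s t, |D s t| ≤ C * |t - s| ^ θ * (2 ^ (1 - θ)) ^ n := by
    intro n
    induction n with
    | zero => simpa using hC
    | succ n ih =>
      intro s t
      have h1 := ih s ((s + t) / 2)
      have h2 := ih ((s + t) / 2) t
      rw [abs_half_sub_left] at h1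
      rw [abs_sub_half] at h2
      have h3 := two_mul_half_rpow (abs_nonneg (t - s)) θ
      rw [hD]
      refine (abs_add_le _ _).trans ((add_le_add h1 h2).trans_eq ?_)
      rw [pow_succ]
      linear_combination (C * (2 ^ (1 - θ)) ^ n) * h3
  have hlim : Filter.Tendsto (fun n : ℕ => C * |t - s| ^ θ * ((2 : ℝ) ^ (1 - θ)) ^ n)
      Filter.atTop (nhds (C * |t - s| ^ θ * 0)) :=
    (tendsto_pow_atTop_nhds_zero_of_lt_one (by positivity)
      (two_rpow_one_sub_lt_one hθ)).const_mul _
  rw [mul_zero] at hlim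
  exact abs_eq_zero.mp (le_antisymm (ge_of_tendsto' hlim fun n => key n s t) (abs_nonneg _))

theorem sum_range_two_mul (a : ℕ → ℝ) (N : ℕ) :
    ∑ j ∈ Finset.range (2 * N), a j = ∑ i ∈ Finset.range N, (a (2 * i) + a (2 * i + 1)) := by
  induction N with
  | zero => simp
  | succ N ih =>
    rw [Finset.sum_range_succ, ← ih, mul_add, mul_one, Finset.sum_range_succ,
      Finset.sum_range_succ, add_assoc]

/-- A midpoint-additive function of intervals close to `g s * (f t - f s)` is additive along
equidistant partitions. -/
theorem eq_sum_equidistant {g f : ℝ → ℝ} {A B κ γ C : ℝ} (hA : 0 ≤ A) (hB : 0 ≤ B)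
    (hC : 0 ≤ C) (hκ : 0 ≤ κ) (hγ : 0 ≤ γ) (hθ : 1 < κ + γ)
    (hg : ∀ s t, |g t - g s| ≤ A * |t - s| ^ κ) (hf : ∀ s t, |f t - f s| ≤ B * |t - s| ^ γ)
    {J : ℝ → ℝ → ℝ} (hJ : ∀ s t, J s t = J s ((s + t) / 2) + J ((s + t) / 2) t)
    (hJC : ∀ s t, |J s t - g s * (f t - f s)| ≤ C * |t - s| ^ (κ + γ))
    {N : ℕ} (hN : 0 < N) (s t : ℝ) :
    J s t = ∑ i ∈ Finset.range N, J (s + i * ((t - s) / N)) (s + (i + 1) * ((t - s) / N)) := by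
  have hN' : (0 : ℝ) < N := by exact_mod_cast hN
  have hN1 : (1 : ℝ) ≤ N := by exact_mod_cast hN
  set P : ℝ → ℝ → ℝ := fun s t =>
    ∑ i ∈ Finset.range N, J (s + i * ((t - s) / N)) (s + (i + 1) * ((t - s) / N)) with hP
  -- Both sides equal the sum of `J` over `2 * N` equal pieces: on the left each piece is bisected,
  -- on the right each half is cut into `N`.
  have hPadd : ∀ s t, P s t = P s ((s + t) / 2) + P ((s + t) / 2) t := by
    intro s t
    set a : ℕ → ℝ := fun j =>
      J (s + j * ((t - s) / (2 * N))) (s + (j + 1) * ((t - s) / (2 * N))) with ha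
    have e1 : P s t = ∑ j ∈ Finset.range (2 * N), a j := by
      rw [sum_range_two_mul]
      refine Finset.sum_congr rfl fun i _ => ?_
      rw [hJ]
      simp only [ha]
      push_cast
      congr 2 <;> field_simp <;> ring
    have e2 : P s ((s + t) / 2) = ∑ j ∈ Finset.range N, a j := by
      refine Finset.sum_congr rfl fun i _ => ?_
      simp only [ha]
      congr 1 <;> field_simp <;> ring
    have e3 : P ((s + t) / 2) t = ∑ j ∈ Finset.range N, a (N + j) := by
      refine Finset.sum_congr rfl fun i _ => ?_
      simp only [ha]
      push_cast
      congr 1 <;> field_simp <;> ring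
    rw [e1, e2, e3, two_mul, Finset.sum_range_add]
  -- The constant grows with `N`, but `N` is fixed, so `eq_zero_of_midpoint_additive` still applies
  -- to `J - P`.
  have hbound : ∀ s t, |J s t - P s t| ≤ (C + N * (C + A * B)) * |t - s| ^ (κ + γ) := by
    intro s t
    have tel : f t - f s = ∑ i ∈ Finset.range N,
        (f (s + (i + 1) * ((t - s) / N)) - f (s + i * ((t - s) / N))) := by
      have := Finset.sum_range_sub (fun i : ℕ => f (s + i * ((t - s) / N))) N
      push_cast at this
      rw [this]
      congr 2 <;> field_simp <;> ring
    have hterm : ∀ i ∈ Finset.range N,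
        |J (s + i * ((t - s) / N)) (s + (i + 1) * ((t - s) / N)) -
          g s * (f (s + (i + 1) * ((t - s) / N)) - f (s + i * ((t - s) / N)))| ≤
          (C + A * B) * |t - s| ^ (κ + γ) := by
      intro i hi
      have hi' : (i : ℝ) ≤ N := by exact_mod_cast (Finset.mem_range.mp hi).le
      have d1 : |s + (i + 1) * ((t - s) / N) - (s + i * ((t - s) / N))| ≤ |t - s| := by
        rw [show s + (i + 1) * ((t - s) / N) - (s + i * ((t - s) / N)) = (t - s) / N by ring,
          abs_div, abs_of_pos hN']
        exact div_le_self (abs_nonneg _) hN1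
      have d2 : |s + i * ((t - s) / N) - s| ≤ |t - s| := by
        rw [add_sub_cancel_left, abs_mul, abs_div, abs_of_pos hN', Nat.abs_cast, ← mul_div_assoc,
          div_le_iff₀ hN', mul_comm]
        gcongr
      set u := s + i * ((t - s) / N)
      set v := s + (i + 1) * ((t - s) / N)
      have h1 : |J u v - g u * (f v - f u)| ≤ C * |t - s| ^ (κ + γ) :=
        (hJC u v).trans (by gcongr)
      have h2 : |(g u - g s) * (f v - f u)| ≤ A * B * |t - s| ^ (κ + γ) := by
        rw [abs_mul, Real.rpow_add_of_nonneg (abs_nonneg _) hκ hγ]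
        calc _ ≤ (A * |t - s| ^ κ) * (B * |t - s| ^ γ) := by
              gcongr
              · exact (hg _ _).trans (by gcongr)
              · exact (hf _ _).trans (by gcongr)
          _ = _ := by ring
      rw [show J u v - g s * (f v - f u) = (J u v - g u * (f v - f u)) +
        (g u - g s) * (f v - f u) by ring]
      refine (abs_add_le _ _).trans ((add_le_add h1 h2).trans_eq (by ring))
    have h4 : |P s t - g s * (f t - f s)| ≤ N * ((C + A * B) * |t - s| ^ (κ + γ)) := by
      rw [tel, Finset.mul_sum, ← Finset.sum_sub_distrib]
      refine (Finset.abs_sum_le_sum_abs _ _).trans ((Finset.sum_le_sum hterm).trans_eq ?_)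
      simp
    rw [show J s t - P s t = (J s t - g s * (f t - f s)) - (P s t - g s * (f t - f s)) by ring]
    refine (abs_sub _ _).trans ((add_le_add (hJC s t) h4).trans_eq (by ring))
  have := eq_zero_of_midpoint_additive (D := fun s t => J s t - P s t) hθ
    (fun s t => by rw [hJ s t, hPadd s t]; ring) hbound s t
  linarith

/-- The sewing lemma for `g s * (f t - f s)`: the indefinite Young integral of Hölder functions. -/
theorem exists_young_sewing {g f : ℝ → ℝ} {A B κ γ : ℝ} (hA : 0 ≤ A) (hB : 0 ≤ B)
    (hκ : 0 ≤ κ) (hγ : 0 ≤ γ) (hθ : 1 < κ + γ) (hgc : Continuous g) (hfc : Continuous f)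
    (hg : ∀ s t, |g t - g s| ≤ A * |t - s| ^ κ) (hf : ∀ s t, |f t - f s| ≤ B * |t - s| ^ γ) :
    ∃ J : ℝ → ℝ → ℝ, (∀ s u t, s ≤ u → u ≤ t → J s t = J s u + J u t) ∧
      ∀ s t, |J s t - g s * (f t - f s)| ≤
        A * B / (1 - 2 ^ (1 - (κ + γ))) * |t - s| ^ (κ + γ) := by
  set r : ℝ := 2 ^ (1 - (κ + γ)) with hr
  have hr1 : r < 1 := two_rpow_one_sub_lt_one hθ
  have hr0 : 0 < r := by positivity
  have hstep : ∀ s t n, dist (dyadicSum g f n s t) (dyadicSum g f (n + 1) s t) ≤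
      A * B * |t - s| ^ (κ + γ) * r ^ n := fun s t n => by
    rw [dist_comm, Real.dist_eq]
    exact abs_dyadicSum_succ_sub_le hA hB hκ hγ hg hf n s t
  choose J hJ using fun s t => cauchySeq_tendsto_of_complete
    (cauchySeq_of_le_geometric r _ hr1 (hstep s t))
  have hJn : ∀ s t n, |J s t - dyadicSum g f n s t| ≤
      A * B * |t - s| ^ (κ + γ) * r ^ n / (1 - r) := fun s t n => by
    rw [abs_sub_comm, ← Real.dist_eq]
    exact dist_le_of_le_geometric_of_tendsto r _ hr1 (hstep s t) (hJ s t) n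
  have hmid : ∀ s t, J s t = J s ((s + t) / 2) + J ((s + t) / 2) t := fun s t =>
    tendsto_nhds_unique ((hJ s t).comp (Filter.tendsto_add_atTop_nat 1))
      ((hJ s ((s + t) / 2)).add (hJ ((s + t) / 2) t))
  have hloc : ∀ s t, |J s t - g s * (f t - f s)| ≤
      A * B / (1 - r) * |t - s| ^ (κ + γ) := fun s t =>
    (hJn s t 0).trans_eq (by rw [pow_zero]; ring)
  have h1r : 0 < 1 - r := by linarith
  -- The geometric tail is uniform where `|t - s|` stays bounded, so the convergence is locally
  -- uniform.
  have hcont : Continuous fun q : ℝ × ℝ => J q.1 q.2 := by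
    have hloc : TendstoLocallyUniformly
        (fun (n : ℕ) (q : ℝ × ℝ) => dyadicSum g f n q.1 q.2) (fun q => J q.1 q.2)
        Filter.atTop := by
      rw [Metric.tendstoLocallyUniformly_iff]
      intro e he q
      obtain ⟨R, hR⟩ : ∃ R, R = |q.2 - q.1| + 1 := ⟨_, rfl⟩
      have hR0 : 0 < R := by rw [hR]; positivity
      refine ⟨{q' | |q'.2 - q'.1| < R}, ?_, ?_⟩
      · refine IsOpen.mem_nhds (isOpen_lt (by fun_prop) continuous_const) ?_
        simp [hR]
      · have hlim : Filter.Tendsto (fun n : ℕ => A * B * R ^ (κ + γ) * r ^ n / (1 - r))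
            Filter.atTop (nhds (A * B * R ^ (κ + γ) * 0 / (1 - r))) :=
          ((tendsto_pow_atTop_nhds_zero_of_lt_one hr0.le hr1).const_mul _).div_const _
        rw [mul_zero, zero_div] at hlim
        filter_upwards [hlim.eventually (gt_mem_nhds he)] with n hn q' hq'
        rw [Real.dist_eq]
        refine ((hJn _ _ n).trans ?_).trans_lt hn
        have : |q'.2 - q'.1| ≤ R := le_of_lt hq'
        gcongr
    exact hloc.continuous (Filter.Eventually.of_forall fun n =>
      continuous_dyadicSum hgc hfc n).frequently
  refine ⟨J, ?_, hloc⟩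
  have hC0 : 0 ≤ A * B / (1 - r) := by positivity
  -- At a division point of ratio `k / N`, the partition into `N` equal pieces splits into
  -- equidistant partitions of the two sides, with `k` and `N - k` pieces of the same length.
  have hrat : ∀ (s t : ℝ) (k N : ℕ), 0 < k → k < N →
      J s t = J s (s + (k / N : ℝ) * (t - s)) + J (s + (k / N : ℝ) * (t - s)) t := by
    intro s t k N hk hkN
    have hN' : (0 : ℝ) < N := by exact_mod_cast hk.trans hkN
    have hk' : (0 : ℝ) < k := by exact_mod_cast hk
    obtain ⟨l, rfl⟩ := Nat.exists_eq_add_of_lt hkN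
    have hl' : (0 : ℝ) < (l + 1 : ℕ) := by positivity
    rw [eq_sum_equidistant hA hB hC0 hκ hγ hθ hg hf hmid hloc (N := k + l + 1) (by omega) s t,
      eq_sum_equidistant hA hB hC0 hκ hγ hθ hg hf hmid hloc hk s,
      eq_sum_equidistant hA hB hC0 hκ hγ hθ hg hf hmid hloc (N := l + 1) (by omega) _ t,
      add_assoc k, Finset.sum_range_add]
    push_cast at hN' hl' ⊢
    congr 1
    · refine Finset.sum_congr rfl fun i _ => ?_
      congr 1 <;> field_simp <;> ring
    · refine Finset.sum_congr rfl fun i _ => ?_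
      congr 1 <;> field_simp <;> ring
  intro s u t hsu hut
  rcases hsu.eq_or_lt with rfl | hsu
  · have : J s s = 0 := by have := hmid s s; simp only [add_self_div_two] at this; linarith
    rw [this, zero_add]
  rcases hut.eq_or_lt with rfl | hut
  · have : J u u = 0 := by have := hmid u u; simp only [add_self_div_two] at this; linarith
    rw [this, add_zero]
  set l := (u - s) / (t - s) with hl
  have hts : 0 < t - s := by linarith
  have hl0 : 0 < l := div_pos (by linarith) hts
  have hl1 : l < 1 := (div_lt_one hts).mpr (by linarith)
  have hu : s + l * (t - s) = u := by rw [hl]; field_simp; ring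
  -- The rational ratios `⌊l * N⌋₊ / N` tend to `l`; continuity of `J` carries additivity to the
  -- limit.
  have hfl := (tendsto_nat_floor_mul_div_atTop hl0.le).comp
    (tendsto_natCast_atTop_atTop (R := ℝ))
  have hlim : Filter.Tendsto (fun N : ℕ =>
      J s (s + (((⌊l * N⌋₊ : ℕ) : ℝ) / N) * (t - s)) +
        J (s + (((⌊l * N⌋₊ : ℕ) : ℝ) / N) * (t - s)) t) Filter.atTop
      (nhds (J s (s + l * (t - s)) + J (s + l * (t - s)) t)) := by
    have hc : Continuous fun l : ℝ => J s (s + l * (t - s)) + J (s + l * (t - s)) t :=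
      (hcont.comp (f := fun l : ℝ => (s, s + l * (t - s))) (by fun_prop)).add
        (hcont.comp (f := fun l : ℝ => (s + l * (t - s), t)) (by fun_prop))
    exact (hc.tendsto l).comp hfl
  rw [hu] at hlim
  refine tendsto_nhds_unique (tendsto_const_nhds.congr' ?_) hlim
  obtain ⟨N0, hN0⟩ := exists_nat_gt (1 / l)
  filter_upwards [Filter.eventually_ge_atTop N0, Filter.eventually_gt_atTop 0] with N hN hNpos
  have hN' : (0 : ℝ) < N := by exact_mod_cast hNpos
  have hNl : 1 < l * N := by
    have : (N0 : ℝ) ≤ N := by exact_mod_cast hN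
    have h2 := (div_lt_iff₀ hl0).mp (hN0.trans_le this)
    linarith
  refine hrat s t _ N (Nat.floor_pos.mpr hNl.le) ?_
  rw [Nat.floor_lt (by positivity)]
  nlinarith

/-! ### Pointwise estimates and constructors for Hölder spaces -/

namespace HolderSpace

variable {γ : ℝ≥0}

@[ext]
theorem ext {f g : HolderSpace γ} (h : ∀ t, f t = g t) : f = g :=
  Subtype.ext (ContinuousMap.ext h)

@[simp]
theorem add_apply (f g : HolderSpace γ) (t : unitInterval) : (f + g) t = f t + g t := rfl

@[simp]
theorem sub_apply (f g : HolderSpace γ) (t : unitInterval) : (f - g) t = f t - g t := rfl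

@[simp]
theorem smul_apply (c : ℝ) (f : HolderSpace γ) (t : unitInterval) : (c • f) t = c * f t := rfl

theorem norm_toContinuousMap_le (f : HolderSpace γ) : ‖f.toContinuousMap‖ ≤ ‖f‖ := by
  rw [norm_def]; linarith [NNReal.coe_nonneg (nnHolderNorm γ (f : unitInterval → ℝ))]

theorem nnHolderNorm_le_norm (f : HolderSpace γ) :
    (nnHolderNorm γ (f : unitInterval → ℝ) : ℝ) ≤ ‖f‖ := by
  rw [norm_def]; linarith [norm_nonneg f.toContinuousMap]

theorem abs_apply_le (f : HolderSpace γ) (t : unitInterval) : |f t| ≤ ‖f‖ :=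
  (f.toContinuousMap.norm_coe_le_norm t).trans f.norm_toContinuousMap_le

theorem abs_sub_le (f : HolderSpace γ) (s t : unitInterval) :
    |f t - f s| ≤ ‖f‖ * |(t : ℝ) - s| ^ (γ : ℝ) := by
  have h := f.memHolder.holderWith.dist_le t s
  rw [Real.dist_eq, Subtype.dist_eq, Real.dist_eq] at h
  exact h.trans (by gcongr; exact f.nnHolderNorm_le_norm)

theorem continuous_coe (f : HolderSpace γ) : Continuous (f : unitInterval → ℝ) :=
  f.toContinuousMap.continuous

theorem holderWith_of_abs_sub_le {f : unitInterval → ℝ} {B : ℝ≥0}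
    (h : ∀ s t : unitInterval, |f t - f s| ≤ B * |(t : ℝ) - s| ^ (γ : ℝ)) : HolderWith B γ f := by
  intro s t
  rw [edist_dist, edist_dist, ENNReal.ofReal_rpow_of_nonneg dist_nonneg γ.coe_nonneg,
    ← ENNReal.ofReal_coe_nnreal, ← ENNReal.ofReal_mul B.coe_nonneg]
  refine ENNReal.ofReal_le_ofReal ?_
  rw [Real.dist_eq, Subtype.dist_eq, Real.dist_eq]
  exact h t s

theorem continuous_of_abs_sub_le (hγ : 0 < γ) {f : unitInterval → ℝ} {B : ℝ} (hB : 0 ≤ B)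
    (h : ∀ s t : unitInterval, |f t - f s| ≤ B * |(t : ℝ) - s| ^ (γ : ℝ)) : Continuous f :=
  (holderWith_of_abs_sub_le (B := ⟨B, hB⟩) h).continuous hγ

/-- The element of `C^γ` given by a function with a Hölder bound. -/
def ofBound (hγ : 0 < γ) (f : unitInterval → ℝ) {B : ℝ} (hB : 0 ≤ B)
    (h : ∀ s t : unitInterval, |f t - f s| ≤ B * |(t : ℝ) - s| ^ (γ : ℝ)) : HolderSpace γ :=
  ⟨⟨f, continuous_of_abs_sub_le hγ hB h⟩, (holderWith_of_abs_sub_le (B := ⟨B, hB⟩) h).memHolder⟩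

@[simp]
theorem ofBound_apply (hγ : 0 < γ) (f : unitInterval → ℝ) {B : ℝ} (hB : 0 ≤ B)
    (h : ∀ s t : unitInterval, |f t - f s| ≤ B * |(t : ℝ) - s| ^ (γ : ℝ)) (t : unitInterval) :
    ofBound hγ f hB h t = f t := rfl

theorem norm_le_of_bounds {f : HolderSpace γ} {A B : ℝ} (hA : 0 ≤ A) (hB : 0 ≤ B)
    (h : ∀ t, |f t| ≤ A)
    (h' : ∀ s t : unitInterval, |f t - f s| ≤ B * |(t : ℝ) - s| ^ (γ : ℝ)) : ‖f‖ ≤ A + B := by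
  rw [norm_def]
  refine add_le_add ((ContinuousMap.norm_le _ hA).mpr h) ?_
  exact_mod_cast (holderWith_of_abs_sub_le (B := ⟨B, hB⟩) h').nnholderNorm_le

end HolderSpace

theorem unitInterval.abs_coe_sub_le_one (s t : unitInterval) : |(t : ℝ) - s| ≤ 1 :=
  abs_sub_le_iff.mpr ⟨by linarith [t.2.2, s.2.1], by linarith [s.2.2, t.2.1]⟩

theorem unitInterval.abs_coe_sub_rpow_le {a b : ℝ} (ha : 0 ≤ a) (hb : a ≤ b)
    (s t : unitInterval) : |(t : ℝ) - s| ^ b ≤ |(t : ℝ) - s| ^ a := by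
  rcases hb.eq_or_lt with rfl | hb
  · exact le_rfl
  · exact Real.rpow_le_rpow_of_exponent_ge_of_imp (abs_nonneg _)
      (unitInterval.abs_coe_sub_le_one s t) hb.le (fun _ h => absurd h (by linarith))

theorem unitInterval.abs_coe_sub_le_rpow {a : ℝ} (ha : 0 ≤ a) (ha1 : a ≤ 1)
    (s t : unitInterval) : |(t : ℝ) - s| ≤ |(t : ℝ) - s| ^ a := by
  simpa using unitInterval.abs_coe_sub_rpow_le ha ha1 s t

/-! ### Young integrals of Hölder functions on the unit interval -/

/-- The hypothesis concerns a single Riemann term, so one lemma covers linearity in the integrand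
and in the integrator. -/
theorem HasYoungIntegral.of_linear_combination {g₁ f₁ g₂ f₂ g f : unitInterval → ℝ}
    {a b : unitInterval} {J₁ J₂ : ℝ} (h₁ : HasYoungIntegral g₁ f₁ a b J₁)
    (h₂ : HasYoungIntegral g₂ f₂ a b J₂) (c₁ c₂ : ℝ)
    (h : ∀ x u v, g x * (f v - f u) = c₁ * (g₁ x * (f₁ v - f₁ u)) + c₂ * (g₂ x * (f₂ v - f₂ u))) :
    HasYoungIntegral g f a b (c₁ * J₁ + c₂ * J₂) := by
  refine ⟨h₁.1, fun η hη => ?_⟩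
  have hη' : 0 < η / (|c₁| + |c₂| + 1) := by positivity
  obtain ⟨δ₁, hδ₁, H₁⟩ := h₁.2 _ hη'
  obtain ⟨δ₂, hδ₂, H₂⟩ := h₂.2 _ hη'
  refine ⟨min δ₁ δ₂, lt_min hδ₁ hδ₂, fun n t ξ h0 hn hm => ?_⟩
  have e₁ := H₁ n t ξ h0 hn fun i hi =>
    ⟨(hm i hi).1, (hm i hi).2.1, (hm i hi).2.2.trans_le (min_le_left _ _)⟩
  have e₂ := H₂ n t ξ h0 hn fun i hi =>
    ⟨(hm i hi).1, (hm i hi).2.1, (hm i hi).2.2.trans_le (min_le_right _ _)⟩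
  simp only [h, Finset.sum_add_distrib, ← Finset.mul_sum]
  rw [add_sub_add_comm, ← mul_sub, ← mul_sub]
  refine (abs_add_le _ _).trans_lt ?_
  rw [abs_mul, abs_mul]
  calc _ ≤ |c₁| * (η / (|c₁| + |c₂| + 1)) + |c₂| * (η / (|c₁| + |c₂| + 1)) := by gcongr
    _ = (|c₁| + |c₂|) * η / (|c₁| + |c₂| + 1) := by ring
    _ < η := by rw [div_lt_iff₀ (by positivity)]; nlinarith

section Young

variable {g f : unitInterval → ℝ} {A B κ γ : ℝ}

/-- By additivity the error is a sum over the pieces. On each piece, moving the tag costs `A * B`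
and the local approximation costs `C`, both times length to the power `κ + γ`. The surplus exponent
`κ + γ - 1` gives smallness in the mesh, while the lengths themselves sum to at most `1`. -/
theorem hasYoungIntegral_of_sewing (hA : 0 ≤ A) (hB : 0 ≤ B) (hκ : 0 ≤ κ) (hγ : 0 ≤ γ)
    (hθ : 1 < κ + γ) (hg : ∀ s t : unitInterval, |g t - g s| ≤ A * |(t : ℝ) - s| ^ κ)
    (hf : ∀ s t : unitInterval, |f t - f s| ≤ B * |(t : ℝ) - s| ^ γ)
    {J : unitInterval → unitInterval → ℝ} {C : ℝ} (hC : 0 ≤ C)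
    (hJ : ∀ s u t, s ≤ u → u ≤ t → J s t = J s u + J u t)
    (hJC : ∀ s t : unitInterval,
      |J s t - g s * (f t - f s)| ≤ C * |(t : ℝ) - s| ^ (κ + γ)) {a b : unitInterval}
    (hab : a ≤ b) : HasYoungIntegral g f a b (J a b) := by
  refine ⟨hab, fun η hη => ?_⟩
  set K := C + A * B
  have hK : 0 ≤ K := by positivity
  have hθ' : 0 < κ + γ - 1 := by linarith
  -- Chosen so that `K * δ ^ (κ + γ - 1) < η`; the `+ 1` avoids dividing by zero when `K = 0`.
  set δ := (η / (K + 1)) ^ (κ + γ - 1)⁻¹ with hδ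
  have hδ0 : 0 < δ := by positivity
  have hδθ : δ ^ (κ + γ - 1) = η / (K + 1) := Real.rpow_inv_rpow (by positivity) hθ'.ne'
  refine ⟨δ, hδ0, fun n t ξ h0 hn hm => ?_⟩
  have hmono : ∀ i ≤ n, t 0 ≤ t i := by
    intro i
    induction i with
    | zero => simp
    | succ i ih => exact fun hi => (ih (by omega)).trans ((hm i hi).1.trans (hm i hi).2.1)
  have hsum : ∀ i ≤ n, J (t 0) (t i) = ∑ j ∈ Finset.range i, J (t j) (t (j + 1)) := by
    intro i
    induction i with
    | zero =>
      intro _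
      have := hJ (t 0) (t 0) (t 0) le_rfl le_rfl
      rw [Finset.sum_range_zero]
      linarith
    | succ i ih =>
      intro hi
      rw [Finset.sum_range_succ, ← ih (by omega)]
      exact hJ _ _ _ (hmono i (by omega)) ((hm i hi).1.trans (hm i hi).2.1)
  rw [← h0, ← hn, hsum n le_rfl, ← Finset.sum_sub_distrib]
  have hterm : ∀ i ∈ Finset.range n,
      |g (ξ i) * (f (t (i + 1)) - f (t i)) - J (t i) (t (i + 1))| ≤
        K * (η / (K + 1)) * ((t (i + 1) : ℝ) - t i) := by
    intro i hi
    obtain ⟨m1, m2, m3⟩ := hm i (Finset.mem_range.mp hi)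
    have m1' : (t i : ℝ) ≤ ξ i := m1
    have m2' : (ξ i : ℝ) ≤ t (i + 1) := m2
    have hd : 0 ≤ (t (i + 1) : ℝ) - t i := by linarith
    have h1 := hJC (t i) (t (i + 1))
    have h2 : |(g (ξ i) - g (t i)) * (f (t (i + 1)) - f (t i))| ≤
        A * B * |(t (i + 1) : ℝ) - t i| ^ (κ + γ) := by
      rw [abs_mul, Real.rpow_add_of_nonneg (abs_nonneg _) hκ hγ]
      have h3 : |(ξ i : ℝ) - t i| ≤ |(t (i + 1) : ℝ) - t i| := by
        rw [abs_of_nonneg hd, abs_of_nonneg (by linarith)]; linarith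
      calc _ ≤ (A * |(t (i + 1) : ℝ) - t i| ^ κ) * (B * |(t (i + 1) : ℝ) - t i| ^ γ) := by
            gcongr
            · exact (hg _ _).trans (by gcongr)
            · exact hf _ _
        _ = _ := by ring
    rw [show g (ξ i) * (f (t (i + 1)) - f (t i)) - J (t i) (t (i + 1)) =
      (g (ξ i) - g (t i)) * (f (t (i + 1)) - f (t i)) -
        (J (t i) (t (i + 1)) - g (t i) * (f (t (i + 1)) - f (t i))) by ring]
    refine (abs_sub _ _).trans ((add_le_add h2 h1).trans ?_)
    rw [← add_mul, add_comm (A * B), abs_of_nonneg hd, mul_assoc]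
    refine mul_le_mul_of_nonneg_left ?_ hK
    rw [← hδθ]
    calc ((t (i + 1) : ℝ) - t i) ^ (κ + γ)
        = ((t (i + 1) : ℝ) - t i) ^ (κ + γ - 1) * ((t (i + 1) : ℝ) - t i) := by
          rw [show κ + γ = κ + γ - 1 + 1 by ring,
            Real.rpow_add_of_nonneg hd hθ'.le zero_le_one, Real.rpow_one]; simp
      _ ≤ _ := by gcongr
  refine (Finset.abs_sum_le_sum_abs _ _).trans_lt ((Finset.sum_le_sum hterm).trans_lt ?_)
  rw [← Finset.mul_sum, Finset.sum_range_sub (fun i => (t i : ℝ))]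
  have hle : (t n : ℝ) - t 0 ≤ 1 := by linarith [(t n).2.2, (t 0).2.1]
  calc _ ≤ K * (η / (K + 1)) * 1 := by gcongr
    _ = K * η / (K + 1) := by ring
    _ < η := by rw [div_lt_iff₀ (by positivity)]; nlinarith

/-- Existence, additivity and the Young–Loève estimate for Young integrals. -/
theorem exists_hasYoungIntegral (hA : 0 ≤ A) (hB : 0 ≤ B) (hκ : 0 < κ) (hγ : 0 < γ)
    (hθ : 1 < κ + γ) (hg : ∀ s t : unitInterval, |g t - g s| ≤ A * |(t : ℝ) - s| ^ κ)
    (hf : ∀ s t : unitInterval, |f t - f s| ≤ B * |(t : ℝ) - s| ^ γ) :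
    ∃ J : unitInterval → unitInterval → ℝ,
      (∀ a b, a ≤ b → HasYoungIntegral g f a b (J a b)) ∧
      (∀ s u t, s ≤ u → u ≤ t → J s t = J s u + J u t) ∧
      ∀ s t : unitInterval, |J s t - g s * (f t - f s)| ≤
        A * B / (1 - 2 ^ (1 - (κ + γ))) * |(t : ℝ) - s| ^ (κ + γ) := by
  -- Constant extension beyond the endpoints keeps the Hölder constant, since `projIcc` is a
  -- contraction, so the sewing lemma on the line applies.
  have hext : ∀ {h : unitInterval → ℝ} {D ρ : ℝ}, 0 ≤ D → 0 < ρ →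
      (∀ s t : unitInterval, |h t - h s| ≤ D * |(t : ℝ) - s| ^ ρ) →
      Continuous (fun x => h (projIcc 0 1 zero_le_one x)) ∧
      ∀ s t : ℝ, |h (projIcc 0 1 zero_le_one t) - h (projIcc 0 1 zero_le_one s)| ≤
        D * |t - s| ^ ρ := by
    intro h D ρ hD hρ hh
    constructor
    · have := HolderSpace.continuous_of_abs_sub_le (γ := ⟨ρ, hρ.le⟩) hρ hD hh
      exact this.comp continuous_projIcc
    · intro s t
      exact (hh _ _).trans (mul_le_mul_of_nonneg_left (Real.rpow_le_rpow (abs_nonneg _)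
        (abs_projIcc_sub_projIcc (zero_le_one' ℝ)) hρ.le) hD)
  obtain ⟨hgc, hg'⟩ := hext hA hκ hg
  obtain ⟨hfc, hf'⟩ := hext hB hγ hf
  obtain ⟨J, hJ, hJC⟩ := exists_young_sewing hA hB hκ.le hγ.le hθ hgc hfc hg' hf'
  have hJC' : ∀ s t : unitInterval, |J s t - g s * (f t - f s)| ≤
        A * B / (1 - 2 ^ (1 - (κ + γ))) * |(t : ℝ) - s| ^ (κ + γ) := by
    intro s t
    simpa using hJC s t
  have hadd : ∀ s u t : unitInterval, s ≤ u → u ≤ t → J s t = J s u + J u t :=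
    fun s u t h1 h2 => hJ s u t h1 h2
  have h1 := two_rpow_one_sub_lt_one hθ
  refine ⟨fun s t => J s t, fun a b hab => ?_, hadd, hJC'⟩
  exact hasYoungIntegral_of_sewing hA hB hκ.le hγ.le hθ hg hf
    (J := fun s t => J s t) (div_nonneg (by positivity) (by linarith)) hadd hJC' hab

theorem hasYoungIntegral_youngIntegral (hA : 0 ≤ A) (hB : 0 ≤ B) (hκ : 0 < κ) (hγ : 0 < γ)
    (hθ : 1 < κ + γ) (hg : ∀ s t : unitInterval, |g t - g s| ≤ A * |(t : ℝ) - s| ^ κ)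
    (hf : ∀ s t : unitInterval, |f t - f s| ≤ B * |(t : ℝ) - s| ^ γ) {a b : unitInterval}
    (hab : a ≤ b) : HasYoungIntegral g f a b (youngIntegral g f a b) := by
  obtain ⟨J, hJ, -, -⟩ := exists_hasYoungIntegral hA hB hκ hγ hθ hg hf
  rw [(hJ a b hab).youngIntegral_eq]
  exact hJ a b hab

theorem youngIntegral_add_adjacent (hA : 0 ≤ A) (hB : 0 ≤ B) (hκ : 0 < κ) (hγ : 0 < γ)
    (hθ : 1 < κ + γ) (hg : ∀ s t : unitInterval, |g t - g s| ≤ A * |(t : ℝ) - s| ^ κ)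
    (hf : ∀ s t : unitInterval, |f t - f s| ≤ B * |(t : ℝ) - s| ^ γ) {a b c : unitInterval}
    (hab : a ≤ b) (hbc : b ≤ c) :
    youngIntegral g f a c = youngIntegral g f a b + youngIntegral g f b c := by
  obtain ⟨J, hJ, hadd, -⟩ := exists_hasYoungIntegral hA hB hκ hγ hθ hg hf
  rw [(hJ a b hab).youngIntegral_eq, (hJ b c hbc).youngIntegral_eq,
    (hJ a c (hab.trans hbc)).youngIntegral_eq, hadd a b c hab hbc]

theorem abs_youngIntegral_le (hA : 0 ≤ A) (hB : 0 ≤ B) (hκ : 0 < κ) (hγ : 0 < γ)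
    (hθ : 1 < κ + γ) (hg : ∀ s t : unitInterval, |g t - g s| ≤ A * |(t : ℝ) - s| ^ κ)
    (hf : ∀ s t : unitInterval, |f t - f s| ≤ B * |(t : ℝ) - s| ^ γ) {S : ℝ}
    (hS : ∀ t, |g t| ≤ S) {a b : unitInterval} (hab : a ≤ b) :
    |youngIntegral g f a b| ≤ (S + A / (1 - 2 ^ (1 - (κ + γ)))) * B * |(b : ℝ) - a| ^ γ := by
  obtain ⟨J, hJ, -, hJC⟩ := exists_hasYoungIntegral hA hB hκ hγ hθ hg hf
  rw [(hJ a b hab).youngIntegral_eq]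
  have h1 := two_rpow_one_sub_lt_one hθ
  have h2 : |g a * (f b - f a)| ≤ S * B * |(b : ℝ) - a| ^ γ := by
    rw [abs_mul, mul_assoc]
    exact mul_le_mul (hS a) (hf a b) (abs_nonneg _) ((abs_nonneg _).trans (hS a))
  have h3 : |J a b - g a * (f b - f a)| ≤
      A * B / (1 - 2 ^ (1 - (κ + γ))) * |(b : ℝ) - a| ^ γ := by
    refine (hJC a b).trans (mul_le_mul_of_nonneg_left ?_ ?_)
    · exact unitInterval.abs_coe_sub_rpow_le hγ.le (by linarith) a b
    · exact div_nonneg (by positivity) (by linarith)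
  have h4 := abs_add_le (J a b - g a * (f b - f a)) (g a * (f b - f a))
  rw [sub_add_cancel] at h4
  refine h4.trans ((add_le_add h3 h2).trans_eq (by ring))

theorem continuous_youngIntegral_left (hA : 0 ≤ A) (hB : 0 ≤ B) (hκ : 0 < κ) (hγ : 0 < γ)
    (hθ : 1 < κ + γ) (hg : ∀ s t : unitInterval, |g t - g s| ≤ A * |(t : ℝ) - s| ^ κ)
    (hf : ∀ s t : unitInterval, |f t - f s| ≤ B * |(t : ℝ) - s| ^ γ) :
    Continuous fun u => youngIntegral g f u 1 := by
  obtain ⟨S, hS⟩ : ∃ S, ∀ t, |g t| ≤ S := by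
    have hc := HolderSpace.continuous_of_abs_sub_le (γ := ⟨κ, hκ.le⟩) hκ hA hg
    obtain ⟨S, hS⟩ := isCompact_univ.exists_bound_of_continuousOn hc.continuousOn
    exact ⟨S, fun t => hS t (mem_univ t)⟩
  have hS0 : 0 ≤ S := (abs_nonneg _).trans (hS 0)
  have h1 := two_rpow_one_sub_lt_one hθ
  have hC : 0 ≤ (S + A / (1 - 2 ^ (1 - (κ + γ)))) * B :=
    mul_nonneg (add_nonneg hS0 (div_nonneg hA (by linarith))) hB
  have key : ∀ s t : unitInterval, s ≤ t →
      |youngIntegral g f t 1 - youngIntegral g f s 1| ≤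
      (S + A / (1 - 2 ^ (1 - (κ + γ)))) * B * |(t : ℝ) - s| ^ γ := by
    intro s t hst
    have h2 := youngIntegral_add_adjacent hA hB hκ hγ hθ hg hf hst (unitInterval.le_one' (t := t))
    have h3 := abs_youngIntegral_le hA hB hκ hγ hθ hg hf hS hst
    rw [h2, sub_add_cancel_right, abs_neg]
    exact h3
  refine HolderSpace.continuous_of_abs_sub_le (γ := ⟨γ, hγ.le⟩) hγ hC fun s t => ?_
  rcases le_total s t with hst | hst
  · exact key s t hst
  · rw [abs_sub_comm, abs_sub_comm (t : ℝ)]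
    exact key t s hst

end Young

/-! ### The drift as a bounded bilinear map -/

theorem unitInterval.integral_Iic_sub_integral_Iic {Y : unitInterval → ℝ} (hY : Continuous Y)
    {s t : unitInterval} (hst : s ≤ t) :
    (∫ u in Iic t, Y u) - ∫ u in Iic s, Y u = ∫ u in Ioc s t, Y u := by
  have hint : Integrable Y := hY.integrable_of_hasCompactSupport (HasCompactSupport.of_compactSpace Y)
  rw [← Iic_union_Ioc_eq_Iic hst, setIntegral_union (Iic_disjoint_Ioc le_rfl) measurableSet_Ioc
    hint.integrableOn hint.integrableOn, add_sub_cancel_left]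

theorem unitInterval.abs_integral_Iic_sub_le {Y : unitInterval → ℝ} (hY : Continuous Y) {K : ℝ}
    (hK : ∀ u, |Y u| ≤ K) (s t : unitInterval) :
    |(∫ u in Iic t, Y u) - ∫ u in Iic s, Y u| ≤ K * |(t : ℝ) - s| := by
  have key : ∀ s t : unitInterval, s ≤ t →
      |(∫ u in Iic t, Y u) - ∫ u in Iic s, Y u| ≤ K * |(t : ℝ) - s| := by
    intro s t hst
    have hst' : (0 : ℝ) ≤ t - s := sub_nonneg.mpr hst
    rw [unitInterval.integral_Iic_sub_integral_Iic hY hst]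
    have := norm_setIntegral_le_of_norm_le_const (μ := (volume : Measure unitInterval))
      (s := Ioc s t) (f := Y) (C := K) (measure_lt_top _ _) (fun u _ => hK u)
    rw [Measure.real, unitInterval.volume_Ioc, ENNReal.toReal_ofReal hst'] at this
    rwa [abs_of_nonneg hst']
  rcases le_total s t with hst | hst
  · exact key s t hst
  · rw [abs_sub_comm, abs_sub_comm (t : ℝ)]
    exact key t s hst

theorem unitInterval.abs_integral_Iic_le {Y : unitInterval → ℝ} {K : ℝ}
    (hK : ∀ u, |Y u| ≤ K) (t : unitInterval) : |∫ u in Iic t, Y u| ≤ K := by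
  have := norm_setIntegral_le_of_norm_le_const (μ := (volume : Measure unitInterval))
    (s := Iic t) (f := Y) (C := K) (measure_lt_top _ _) (fun u _ => hK u)
  rw [Measure.real, unitInterval.volume_Iic, ENNReal.toReal_ofReal t.2.1] at this
  refine this.trans (mul_le_of_le_one_right ((abs_nonneg _).trans (hK 0)) t.2.2)

/-- `t ↦ -∫_0^t du (∫_u^1 g df) + t ∫_0^1 ξ g_ξ df_ξ`. -/
noncomputable def youngDrift (g f : unitInterval → ℝ) (t : unitInterval) : ℝ :=
  -(∫ u in Iic t, youngIntegral g f u 1) + t * youngIntegral (fun ξ => ξ * g ξ) f 0 1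

theorem HolderSpace.abs_mul_sub_le {κ : ℝ≥0} (hκ : κ ≤ 1) (g : HolderSpace κ)
    (s t : unitInterval) :
    |t * g t - s * g s| ≤ 2 * ‖g‖ * |(t : ℝ) - s| ^ (κ : ℝ) := by
  rw [show t * g t - s * g s = t * (g t - g s) + (t - s) * g s by ring]
  have h1 : |(t : ℝ) * (g t - g s)| ≤ ‖g‖ * |(t : ℝ) - s| ^ (κ : ℝ) := by
    rw [abs_mul, abs_of_nonneg t.2.1]
    exact (mul_le_of_le_one_left (abs_nonneg _) t.2.2).trans (g.abs_sub_le s t)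
  have h2 : |((t : ℝ) - s) * g s| ≤ ‖g‖ * |(t : ℝ) - s| ^ (κ : ℝ) := by
    rw [abs_mul, mul_comm]
    exact mul_le_mul (g.abs_apply_le s) (unitInterval.abs_coe_sub_le_rpow κ.coe_nonneg hκ s t)
      (abs_nonneg _) (norm_nonneg _)
  refine (abs_add_le _ _).trans ((add_le_add h1 h2).trans_eq (by ring))

section Drift

variable {κ α : ℝ≥0} {γ : ℝ}

/-- Lowers the exponent of the driver from `γ + ε` to `γ`, the one in the Young condition `κ + γ >
1`. -/
theorem HolderSpace.abs_sub_le_of_le (hγ : 0 ≤ γ) (hγα : γ ≤ α) (f : HolderSpace α)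
    (s t : unitInterval) : |f t - f s| ≤ ‖f‖ * |(t : ℝ) - s| ^ γ :=
  (f.abs_sub_le s t).trans (mul_le_mul_of_nonneg_left
    (unitInterval.abs_coe_sub_rpow_le hγ hγα s t) (norm_nonneg _))

theorem HolderSpace.hasYoungIntegral (hκ : 0 < κ) (hγ : 0 < γ) (hγα : γ ≤ α)
    (hθ : 1 < κ + γ) (g : HolderSpace κ) (f : HolderSpace α) {a b : unitInterval} (hab : a ≤ b) :
    HasYoungIntegral g f a b (youngIntegral g f a b) :=
  hasYoungIntegral_youngIntegral (norm_nonneg g) (norm_nonneg f) (NNReal.coe_pos.mpr hκ) hγ hθ g.abs_sub_le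
    (f.abs_sub_le_of_le hγ.le hγα) hab

theorem HolderSpace.hasYoungIntegral_coe_mul (hκ : 0 < κ) (hκ1 : κ ≤ 1) (hγ : 0 < γ)
    (hγα : γ ≤ α) (hθ : 1 < κ + γ) (g : HolderSpace κ) (f : HolderSpace α)
    {a b : unitInterval} (hab : a ≤ b) :
    HasYoungIntegral (fun ξ => ξ * g ξ) f a b (youngIntegral (fun ξ => ξ * g ξ) f a b) :=
  hasYoungIntegral_youngIntegral (mul_nonneg zero_le_two (norm_nonneg g)) (norm_nonneg f) (NNReal.coe_pos.mpr hκ) hγ hθ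
    (g.abs_mul_sub_le hκ1) (f.abs_sub_le_of_le hγ.le hγα) hab

theorem HolderSpace.continuous_youngIntegral (hκ : 0 < κ) (hγ : 0 < γ) (hγα : γ ≤ α)
    (hθ : 1 < κ + γ) (g : HolderSpace κ) (f : HolderSpace α) :
    Continuous fun u => youngIntegral g f u 1 :=
  continuous_youngIntegral_left (norm_nonneg g) (norm_nonneg f) (NNReal.coe_pos.mpr hκ) hγ hθ g.abs_sub_le
    (f.abs_sub_le_of_le hγ.le hγα)

theorem HolderSpace.integrable_youngIntegral (hκ : 0 < κ) (hγ : 0 < γ) (hγα : γ ≤ α)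
    (hθ : 1 < κ + γ) (g : HolderSpace κ) (f : HolderSpace α) :
    Integrable fun u => youngIntegral g f u 1 :=
  (HolderSpace.continuous_youngIntegral hκ hγ hγα hθ g f).integrable_of_hasCompactSupport
    (HasCompactSupport.of_compactSpace _)

/-- `youngDrift` is a bounded bilinear map `C^κ × C^α → C^κ`. -/
theorem exists_youngDrift_bilinear (hκ : 0 < κ) (hκ1 : κ ≤ 1) (hγ : 0 < γ) (hγα : γ ≤ α)
    (hθ : 1 < κ + γ) : ∃ T : HolderSpace κ →L[ℝ] HolderSpace α →L[ℝ] HolderSpace κ,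
      ∀ g f t, T g f t = youngDrift g f t := by
  set c : ℝ := 1 / (1 - 2 ^ (1 - (κ + γ))) with hc
  have hc0 : 0 ≤ c := one_div_nonneg.mpr (by linarith [two_rpow_one_sub_lt_one hθ])
  have hpow : ∀ s t : unitInterval, |(t : ℝ) - s| ^ γ ≤ 1 := fun s t =>
    Real.rpow_le_one (abs_nonneg _) (unitInterval.abs_coe_sub_le_one s t) hγ.le
  have hY : ∀ (g : HolderSpace κ) (f : HolderSpace α) (u : unitInterval),
      |youngIntegral g f u 1| ≤ (1 + c) * ‖g‖ * ‖f‖ := by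
    intro g f u
    refine (abs_youngIntegral_le (norm_nonneg g) (norm_nonneg f) (NNReal.coe_pos.mpr hκ) hγ hθ g.abs_sub_le
      (f.abs_sub_le_of_le hγ.le hγα) g.abs_apply_le unitInterval.le_one').trans ?_
    rw [← one_div_mul_eq_div, ← hc, show (1 + c) * ‖g‖ * ‖f‖ = (‖g‖ + c * ‖g‖) * ‖f‖ * 1 by ring]
    gcongr
    exact hpow _ _
  have hY' : ∀ (g : HolderSpace κ) (f : HolderSpace α),
      |youngIntegral (fun ξ => ξ * g ξ) f 0 1| ≤ (1 + 2 * c) * ‖g‖ * ‖f‖ := by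
    intro g f
    refine (abs_youngIntegral_le (S := ‖g‖) (mul_nonneg zero_le_two (norm_nonneg g))
      (norm_nonneg f) (NNReal.coe_pos.mpr hκ) hγ hθ (g.abs_mul_sub_le hκ1) (f.abs_sub_le_of_le hγ.le hγα) (fun t => ?_)
      unitInterval.le_one').trans ?_
    · rw [abs_mul, abs_of_nonneg t.2.1]
      exact (mul_le_of_le_one_left (abs_nonneg _) t.2.2).trans (g.abs_apply_le t)
    rw [← one_div_mul_eq_div, ← hc,
      show (1 + 2 * c) * ‖g‖ * ‖f‖ = (‖g‖ + c * (2 * ‖g‖)) * ‖f‖ * 1 by ring]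
    gcongr
    exact hpow _ _
  have hcont := fun (g : HolderSpace κ) (f : HolderSpace α) =>
    HolderSpace.continuous_youngIntegral hκ hγ hγα hθ g f
  have hsup : ∀ (g : HolderSpace κ) (f : HolderSpace α) t,
      |youngDrift g f t| ≤ (2 + 3 * c) * ‖g‖ * ‖f‖ := by
    intro g f t
    have h1 := unitInterval.abs_integral_Iic_le (hY g f) t
    have h2 : |(t : ℝ) * youngIntegral (fun ξ => ξ * g ξ) f 0 1| ≤ (1 + 2 * c) * ‖g‖ * ‖f‖ := by
      rw [abs_mul, abs_of_nonneg t.2.1]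
      exact (mul_le_of_le_one_left (abs_nonneg _) t.2.2).trans (hY' g f)
    rw [youngDrift]
    refine (abs_add_le _ _).trans ?_
    rw [abs_neg]
    linarith
  have hlip : ∀ (g : HolderSpace κ) (f : HolderSpace α) (s t : unitInterval),
      |youngDrift g f t - youngDrift g f s| ≤
        (2 + 3 * c) * ‖g‖ * ‖f‖ * |(t : ℝ) - s| ^ (κ : ℝ) := by
    intro g f s t
    have h1 := unitInterval.abs_integral_Iic_sub_le (hcont g f) (hY g f) s t
    have h2 : |((t : ℝ) - s) * youngIntegral (fun ξ => ξ * g ξ) f 0 1| ≤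
        (1 + 2 * c) * ‖g‖ * ‖f‖ * |(t : ℝ) - s| := by
      rw [abs_mul, mul_comm]
      exact mul_le_mul_of_nonneg_right (hY' g f) (abs_nonneg _)
    rw [show youngDrift g f t - youngDrift g f s =
      -((∫ u in Iic t, youngIntegral g f u 1) - ∫ u in Iic s, youngIntegral g f u 1) +
        ((t : ℝ) - s) * youngIntegral (fun ξ => ξ * g ξ) f 0 1 by simp only [youngDrift]; ring]
    refine (abs_add_le _ _).trans ?_
    rw [abs_neg]
    have h3 : (2 + 3 * c) * ‖g‖ * ‖f‖ * |(t : ℝ) - s| ≤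
        (2 + 3 * c) * ‖g‖ * ‖f‖ * |(t : ℝ) - s| ^ (κ : ℝ) := by
      gcongr
      exact unitInterval.abs_coe_sub_le_rpow κ.coe_nonneg hκ1 s t
    linarith
  -- A single identity behind all four bilinearity axioms: additivity takes `c₁ = c₂ = 1`,
  -- homogeneity takes `c₂ = 0`.
  have hlin : ∀ (g g₁ g₂ : HolderSpace κ) (f f₁ f₂ : HolderSpace α) (c₁ c₂ : ℝ),
      (∀ x u v, g x * (f v - f u) =
        c₁ * (g₁ x * (f₁ v - f₁ u)) + c₂ * (g₂ x * (f₂ v - f₂ u))) →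
      ∀ t, youngDrift g f t = c₁ * youngDrift g₁ f₁ t + c₂ * youngDrift g₂ f₂ t := by
    intro g g₁ g₂ f f₁ f₂ c₁ c₂ h t
    have h1 : ∀ u, youngIntegral g f u 1 =
        c₁ * youngIntegral g₁ f₁ u 1 + c₂ * youngIntegral g₂ f₂ u 1 := fun u =>
      ((g₁.hasYoungIntegral hκ hγ hγα hθ f₁ unitInterval.le_one').of_linear_combination
        (g₂.hasYoungIntegral hκ hγ hγα hθ f₂ unitInterval.le_one') c₁ c₂ h).youngIntegral_eq
    have h2 : youngIntegral (fun ξ => ξ * g ξ) f 0 1 =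
        c₁ * youngIntegral (fun ξ => ξ * g₁ ξ) f₁ 0 1 +
          c₂ * youngIntegral (fun ξ => ξ * g₂ ξ) f₂ 0 1 :=
      ((g₁.hasYoungIntegral_coe_mul hκ hκ1 hγ hγα hθ f₁ unitInterval.le_one').of_linear_combination
        (g₂.hasYoungIntegral_coe_mul hκ hκ1 hγ hγα hθ f₂ unitInterval.le_one') c₁ c₂
        (fun x u v => by linear_combination (x : ℝ) * h x u v)).youngIntegral_eq
    simp only [youngDrift, h1, h2]
    rw [integral_add ((g₁.integrable_youngIntegral hκ hγ hγα hθ f₁).integrableOn.const_mul c₁)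
      ((g₂.integrable_youngIntegral hκ hγ hγα hθ f₂).integrableOn.const_mul c₂),
      integral_const_mul, integral_const_mul]
    ring
  have hK : ∀ (g : HolderSpace κ) (f : HolderSpace α), 0 ≤ (2 + 3 * c) * ‖g‖ * ‖f‖ :=
    fun g f => by positivity
  let L : HolderSpace κ →ₗ[ℝ] HolderSpace α →ₗ[ℝ] HolderSpace κ :=
    LinearMap.mk₂ ℝ (fun g f => HolderSpace.ofBound hκ (youngDrift g f) (hK g f) (hlip g f))
      (fun g₁ g₂ f => by
        ext t
        have := hlin (g₁ + g₂) g₁ g₂ f f f 1 1 (fun x u v => by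
          rw [HolderSpace.add_apply]; ring) t
        simpa using this)
      (fun a g f => by
        ext t
        have := hlin (a • g) g g f f f a 0 (fun x u v => by
          rw [HolderSpace.smul_apply]; ring) t
        simpa using this)
      (fun g f₁ f₂ => by
        ext t
        have := hlin g g g (f₁ + f₂) f₁ f₂ 1 1 (fun x u v => by
          rw [HolderSpace.add_apply, HolderSpace.add_apply]; ring) t
        simpa using this)
      (fun a g f => by
        ext t
        have := hlin g g g (a • f) f f a 0 (fun x u v => by
          rw [HolderSpace.smul_apply, HolderSpace.smul_apply]; ring) t
        simpa using this)
  -- The factor `2` counts the sup norm and the Hölder seminorm, which obey the same bound.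
  refine ⟨L.mkContinuous₂ (2 * (2 + 3 * c)) fun g f => ?_, fun g f t => rfl⟩
  refine (HolderSpace.norm_le_of_bounds (f := L g f) (hK g f) (hK g f) (hsup g f) (hlip g f)).trans_eq (by ring)

end Drift

/-! ### Superposition operators on Hölder spaces -/

/-- The common criterion for `S` and for the Sobolev functional; restricting to `‖v‖ ≤ 1` lets the
constant depend on the base point only. -/
theorem hasFDerivAt_of_norm_sub_le_sq {E F : Type*} [NormedAddCommGroup E] [NormedSpace ℝ E]
    [NormedAddCommGroup F] [NormedSpace ℝ F] {f : E → F} {D : E →L[ℝ] F} {x : E} {K : ℝ}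
    (h : ∀ v, ‖v‖ ≤ 1 → ‖f (x + v) - f x - D v‖ ≤ K * ‖v‖ ^ 2) : HasFDerivAt f D x := by
  rw [hasFDerivAt_iff_isLittleO_nhds_zero]
  have h1 : (fun v => f (x + v) - f x - D v) =O[nhds 0] fun v => ‖v‖ ^ 2 := by
    refine Asymptotics.IsBigO.of_bound K ?_
    filter_upwards [Metric.closedBall_mem_nhds (0 : E) one_pos] with v hv
    rw [norm_pow, norm_norm]
    exact h v (mem_closedBall_zero_iff.mp hv)
  refine h1.trans_isLittleO ?_
  rw [Asymptotics.isLittleO_iff]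
  intro c hc
  filter_upwards [Metric.closedBall_mem_nhds (0 : E) hc] with v hv
  rw [norm_pow, norm_norm, sq]
  exact mul_le_mul_of_nonneg_right (mem_closedBall_zero_iff.mp hv) (norm_nonneg v)

theorem abs_sub_le_of_hasDerivAt {f f' : ℝ → ℝ} {C : ℝ} (hf : ∀ y, HasDerivAt f (f' y) y)
    (hC : ∀ y, |f' y| ≤ C) (u v : ℝ) : |f v - f u| ≤ C * |v - u| :=
  convex_univ.norm_image_sub_le_of_norm_hasDerivWithin_le
    (fun y _ => (hf y).hasDerivWithinAt) (fun y _ => hC y) (mem_univ u) (mem_univ v)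

/-- First order Taylor estimate when the derivative is Lipschitz along the segment. -/
theorem abs_sub_sub_mul_le_of_hasDerivAt {f f' : ℝ → ℝ} {C y g : ℝ}
    (hf : ∀ y, HasDerivAt f (f' y) y)
    (hC : ∀ v, |v - y| ≤ |g| → |f' v - f' y| ≤ C * |g|) :
    |f (y + g) - f y - f' y * g| ≤ C * g ^ 2 := by
  have h := (convex_closedBall y |g|).norm_image_sub_le_of_norm_hasDerivWithin_le
    (f := fun v => f v - f' y * v) (f' := fun v => f' v - f' y) (C := C * |g|) (x := y)
    (y := y + g)
    (fun v _ => ((hf v).sub (by simpa using (hasDerivAt_id v).const_mul (f' y))).hasDerivWithinAt)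
    (fun v hv => hC v (by simpa [Real.dist_eq] using Metric.mem_closedBall.mp hv))
    (Metric.mem_closedBall_self (abs_nonneg g)) (Metric.mem_closedBall.mpr (by simp))
  rw [Real.norm_eq_abs, Real.norm_eq_abs, add_sub_cancel_left, mul_assoc, ← sq, sq_abs] at h
  rwa [show f (y + g) - f y - f' y * g = f (y + g) - f' y * (y + g) - (f y - f' y * y) by ring]

/-- Lipschitz estimate for the first order Taylor remainder. -/
theorem abs_taylorRemainder_sub_le {f f₁ f₂ f₃ : ℝ → ℝ} {C₂ C₃ : ℝ}
    (h₀ : ∀ y, HasDerivAt f (f₁ y) y) (h₁ : ∀ y, HasDerivAt f₁ (f₂ y) y)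
    (h₂ : ∀ y, HasDerivAt f₂ (f₃ y) y) (hC₂ : ∀ y, |f₂ y| ≤ C₂) (hC₃ : ∀ y, |f₃ y| ≤ C₃)
    {m : ℝ} (y y' : ℝ) {g g' : ℝ} (hg : |g| ≤ m) (hg' : |g'| ≤ m) :
    |(f (y + g) - f y - f₁ y * g) - (f (y' + g') - f y' - f₁ y' * g')| ≤
      C₃ * m ^ 2 * |y - y'| + C₂ * m * |g - g'| := by
  have hC₂0 : 0 ≤ C₂ := (abs_nonneg _).trans (hC₂ 0)
  have hC₃0 : 0 ≤ C₃ := (abs_nonneg _).trans (hC₃ 0)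
  have hm : 0 ≤ m := (abs_nonneg _).trans hg
  -- Change the base point first, then the increment. With `g` fixed, the derivative of the
  -- remainder in the base point is the Taylor remainder of `f₁`, hence of order `g ^ 2`; this uses
  -- the third derivative.
  have e₁ : |(f (y + g) - f y - f₁ y * g) - (f (y' + g) - f y' - f₁ y' * g)| ≤
      C₃ * m ^ 2 * |y - y'| := by
    refine abs_sub_le_of_hasDerivAt (f := fun v => f (v + g) - f v - f₁ v * g)
      (f' := fun v => f₁ (v + g) - f₁ v - f₂ v * g) (fun v => ?_) (fun v => ?_) y' y
    · exact (((h₀ (v + g)).comp_add_const v g).sub (h₀ v)).sub ((h₁ v).mul_const g)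
    · refine (abs_sub_sub_mul_le_of_hasDerivAt h₁ (C := C₃) fun u hu => ?_).trans ?_
      · exact (abs_sub_le_of_hasDerivAt h₂ hC₃ v u).trans (by gcongr)
      · rw [← sq_abs g]
        gcongr
  have e₂ : |(f (y' + g) - f y' - f₁ y' * g) - (f (y' + g') - f y' - f₁ y' * g')| ≤
      C₂ * m * |g - g'| := by
    refine (convex_closedBall (0 : ℝ) m).norm_image_sub_le_of_norm_hasDerivWithin_le
      (f := fun v => f (y' + v) - f y' - f₁ y' * v) (f' := fun v => f₁ (y' + v) - f₁ y')
      (fun v _ => ?_) (fun v hv => ?_) (by simpa using hg') (by simpa using hg)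
    · refine HasDerivAt.hasDerivWithinAt ?_
      exact (((h₀ (y' + v)).comp_const_add y' v).sub_const _).sub
        (by simpa using (hasDerivAt_id v).const_mul (f₁ y'))
    · have := abs_sub_le_of_hasDerivAt h₁ hC₂ y' (y' + v)
      rw [add_sub_cancel_left] at this
      refine this.trans ?_
      have : |v| ≤ m := by simpa using hv
      gcongr
  exact (abs_sub_le _ _ _).trans (add_le_add e₁ e₂)

namespace HolderSpace

variable {κ : ℝ≥0}

theorem abs_mul_sub_mul_le (w g : HolderSpace κ) (s t : unitInterval) :
    |w t * g t - w s * g s| ≤ 2 * ‖w‖ * ‖g‖ * |(t : ℝ) - s| ^ (κ : ℝ) := by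
  rw [show w t * g t - w s * g s = w t * (g t - g s) + (w t - w s) * g s by ring]
  have e₁ : |w t * (g t - g s)| ≤ ‖w‖ * (‖g‖ * |(t : ℝ) - s| ^ (κ : ℝ)) := by
    rw [abs_mul]
    exact mul_le_mul (w.abs_apply_le t) (g.abs_sub_le s t) (abs_nonneg _) (norm_nonneg _)
  have e₂ : |(w t - w s) * g s| ≤ ‖w‖ * |(t : ℝ) - s| ^ (κ : ℝ) * ‖g‖ := by
    rw [abs_mul]
    exact mul_le_mul (w.abs_sub_le s t) (g.abs_apply_le s) (abs_nonneg _)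
      ((abs_nonneg _).trans (w.abs_sub_le s t))
  exact (abs_add_le _ _).trans ((add_le_add e₁ e₂).trans_eq (by ring))

/-- Pointwise multiplication by an element of `C^κ`. -/
theorem exists_mulLeft (hκ : 0 < κ) (w : HolderSpace κ) :
    ∃ D : HolderSpace κ →L[ℝ] HolderSpace κ, ∀ g t, D g t = w t * g t := by
  have hK : ∀ g : HolderSpace κ, 0 ≤ 2 * ‖w‖ * ‖g‖ := fun g => by positivity
  let L : HolderSpace κ →ₗ[ℝ] HolderSpace κ :=
    { toFun := fun g => ofBound hκ (fun t => w t * g t) (hK g) (w.abs_mul_sub_mul_le g)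
      map_add' := fun g g' => by ext t; simp [mul_add]
      map_smul' := fun c g => by ext t; simp [mul_left_comm] }
  refine ⟨L.mkContinuous (3 * ‖w‖) fun g => ?_, fun g t => rfl⟩
  refine (norm_le_of_bounds (f := L g) (A := ‖w‖ * ‖g‖) (by positivity) (hK g) (fun t => ?_)
    (w.abs_mul_sub_mul_le g)).trans_eq (by ring)
  change |w t * g t| ≤ _
  rw [abs_mul]
  exact mul_le_mul (w.abs_apply_le t) (g.abs_apply_le t) (abs_nonneg _) (norm_nonneg _)

theorem exists_comp (hκ : 0 < κ) {f f₁ : ℝ → ℝ} {C₁ : ℝ} (h₀ : ∀ y, HasDerivAt f (f₁ y) y)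
    (hC₁ : ∀ y, |f₁ y| ≤ C₁) (z : HolderSpace κ) : ∃ w : HolderSpace κ, ∀ t, w t = f (z t) := by
  have hC₁0 : 0 ≤ C₁ := (abs_nonneg _).trans (hC₁ 0)
  refine ⟨ofBound hκ (fun t => f (z t)) (B := C₁ * ‖z‖) (by positivity) fun s t => ?_,
    fun t => rfl⟩
  rw [mul_assoc]
  exact (abs_sub_le_of_hasDerivAt h₀ hC₁ _ _).trans
    (mul_le_mul_of_nonneg_left (z.abs_sub_le s t) hC₁0)

/-- The superposition operator `z ↦ f ∘ z` is Fréchet differentiable on `C^κ`. -/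
theorem exists_comp_hasFDerivAt (hκ : 0 < κ) {f f₁ f₂ f₃ : ℝ → ℝ} {C₁ C₂ C₃ : ℝ}
    (h₀ : ∀ y, HasDerivAt f (f₁ y) y) (h₁ : ∀ y, HasDerivAt f₁ (f₂ y) y)
    (h₂ : ∀ y, HasDerivAt f₂ (f₃ y) y) (hC₁ : ∀ y, |f₁ y| ≤ C₁) (hC₂ : ∀ y, |f₂ y| ≤ C₂)
    (hC₃ : ∀ y, |f₃ y| ≤ C₃) :
    ∃ S : HolderSpace κ → HolderSpace κ, (∀ z t, S z t = f (z t)) ∧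
      ∀ z, ∃ D : HolderSpace κ →L[ℝ] HolderSpace κ,
        (∀ g t, D g t = f₁ (z t) * g t) ∧ HasFDerivAt S D z := by
  have hC₂0 : 0 ≤ C₂ := (abs_nonneg _).trans (hC₂ 0)
  have hC₃0 : 0 ≤ C₃ := (abs_nonneg _).trans (hC₃ 0)
  choose S hS using exists_comp hκ h₀ hC₁
  refine ⟨S, hS, fun z => ?_⟩
  obtain ⟨w, hw⟩ := exists_comp hκ h₁ hC₂ z
  obtain ⟨D, hD⟩ := exists_mulLeft hκ w
  refine ⟨D, fun g t => by rw [hD, hw], ?_⟩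
  refine hasFDerivAt_of_norm_sub_le_sq (K := C₂ + (C₃ * ‖z‖ + C₂)) fun g _ => ?_
  have hval : ∀ t, (S (z + g) - S z - D g) t = f (z t + g t) - f (z t) - f₁ (z t) * g t := by
    intro t
    simp only [sub_apply, hS, hD, hw, add_apply]
  refine (norm_le_of_bounds (A := C₂ * ‖g‖ ^ 2) (B := (C₃ * ‖z‖ + C₂) * ‖g‖ ^ 2) (by positivity)
    (by positivity) (fun t => ?_) (fun s t => ?_)).trans_eq (by ring)
  · rw [hval]
    refine (abs_sub_sub_mul_le_of_hasDerivAt h₀ (C := C₂) fun u hu => ?_).trans ?_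
    · exact (abs_sub_le_of_hasDerivAt h₁ hC₂ _ u).trans (by gcongr)
    · rw [← sq_abs (g t)]
      gcongr
      exact g.abs_apply_le t
  · rw [hval, hval]
    refine (abs_taylorRemainder_sub_le h₀ h₁ h₂ hC₂ hC₃ _ _ (g.abs_apply_le t)
      (g.abs_apply_le s)).trans ?_
    calc _ ≤ C₃ * ‖g‖ ^ 2 * (‖z‖ * |(t : ℝ) - s| ^ (κ : ℝ)) +
          C₂ * ‖g‖ * (‖g‖ * |(t : ℝ) - s| ^ (κ : ℝ)) := by
          gcongr
          · exact z.abs_sub_le s t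
          · exact g.abs_sub_le s t
      _ = _ := by ring

end HolderSpace

/-! ### The Sobolev functional -/

theorem intervalIntegrable_abs_rpow {s : ℝ} (hs : -1 < s) :
    IntervalIntegrable (fun r : ℝ => |r| ^ s) volume (-1) 1 := by
  have h1 : IntervalIntegrable (fun r : ℝ => |r| ^ s) volume 0 1 := by
    refine (intervalIntegral.intervalIntegrable_rpow' (a := 0) (b := 1) hs).congr ?_
    intro r hr
    rw [uIoc_of_le zero_le_one] at hr
    simp only [abs_of_pos hr.1]
  have h2 : IntervalIntegrable (fun r : ℝ => |r| ^ s) volume (-1) 0 := by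
    have := ((IntervalIntegrable.iff_comp_neg enorm_ne_top).mp h1).symm
    simpa using this
  exact h2.trans h1

/-- On the square the kernel agrees almost everywhere with the integrand of the convolution of
`1_[0,1]` with the truncated power, and that integrand is integrable on the plane. -/
theorem integrable_abs_sub_rpow {s : ℝ} (hs : -1 < s) :
    Integrable fun q : unitInterval × unitInterval => |(q.1 : ℝ) - q.2| ^ s := by
  have hk : Integrable ((Ioc (-1 : ℝ) 1).indicator fun r => |r| ^ s) :=
    (integrable_indicator_iff measurableSet_Ioc).mpr
      ((intervalIntegrable_iff_integrableOn_Ioc_of_le (by norm_num)).mp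
        (intervalIntegrable_abs_rpow hs))
  have h1 : Integrable ((Icc (0 : ℝ) 1).indicator fun _ => (1 : ℝ)) :=
    (integrable_indicator_iff measurableSet_Icc).mpr (integrableOn_const (by simp))
  have hc := (h1.convolution_integrand (ContinuousLinearMap.mul ℝ ℝ) hk).mono_measure
    (μ := (volume.restrict (Icc (0 : ℝ) 1)).prod (volume.restrict (Icc (0 : ℝ) 1)))
    (by rw [Measure.prod_restrict]; exact Measure.restrict_le_self)
  have hmp : MeasurePreserving (Prod.map ((↑) : unitInterval → ℝ) ((↑) : unitInterval → ℝ))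
      (volume.prod volume)
      ((volume.restrict (Icc (0 : ℝ) 1)).prod (volume.restrict (Icc (0 : ℝ) 1))) :=
    unitInterval.measurePreserving_coe.prod unitInterval.measurePreserving_coe
  have hI := hmp.integrable_comp_of_integrable hc
  refine hI.congr ?_
  have hne : ∀ᵐ q : unitInterval × unitInterval ∂(volume.prod volume),
      (q.1 : ℝ) - q.2 ∈ Ioc (-1 : ℝ) 1 := by
    -- The half-open truncation misses the difference `-1`, which can occur only when `q.1 = 0`, a
    -- null set.
    have h0 : ∀ᵐ q : unitInterval × unitInterval ∂(volume.prod volume), q.1 ≠ 0 :=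
      Measure.quasiMeasurePreserving_fst.ae (p := fun x : unitInterval => x ≠ 0)
        (by simp [ae_iff])
    filter_upwards [h0] with q hq
    have hq' : (0 : ℝ) < q.1 := unitInterval.pos_iff_ne_zero.mpr hq
    exact ⟨by linarith [q.2.2.2], by linarith [q.1.2.2, q.2.2.1]⟩
  filter_upwards [hne] with q hq
  have h3 : (q.2 : ℝ) ∈ Icc (0 : ℝ) 1 := q.2.2
  simp only [Function.comp_apply, Prod.map_fst, Prod.map_snd, ContinuousLinearMap.mul_apply',
    indicator_of_mem h3, indicator_of_mem hq, one_mul]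

/-- The odd power has derivative `(q - 1) * |r| ^ (q - 2)`. For equal signs the mean value
inequality applies, after reflection if both are negative. For opposite signs the two magnitudes add
up and `q - 1 ≥ 1` suffices. -/
theorem abs_sub_abs_rpow_mul_self_le {q M u v : ℝ} (hq : 2 ≤ q) (hu : |u| ≤ M) (hv : |v| ≤ M) :
    |(|u| ^ (q - 2) * u) - |v| ^ (q - 2) * v| ≤ (q - 1) * M ^ (q - 2) * |u - v| := by
  have hpos : ∀ u v : ℝ, 0 ≤ u → 0 ≤ v → u ≤ M → v ≤ M →
      |(|u| ^ (q - 2) * u) - |v| ^ (q - 2) * v| ≤ (q - 1) * M ^ (q - 2) * |u - v| := by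
    intro u v hu hv huM hvM
    have e : ∀ r : ℝ, 0 ≤ r → |r| ^ (q - 2) * r = r ^ (q - 1) := by
      intro r hr
      rw [abs_of_nonneg hr, show q - 1 = q - 2 + 1 by ring,
        Real.rpow_add_of_nonneg hr (by linarith) zero_le_one, Real.rpow_one]
    rw [e u hu, e v hv]
    refine (convex_Icc (0 : ℝ) M).norm_image_sub_le_of_norm_hasDerivWithin_le
      (f := fun r => r ^ (q - 1)) (f' := fun r => (q - 1) * r ^ (q - 2)) (fun r _ => ?_)
      (fun r hr => ?_) ⟨hv, hvM⟩ ⟨hu, huM⟩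
    · have := Real.hasDerivAt_rpow_const (x := r) (p := q - 1) (Or.inr (by linarith))
      rw [show q - 1 - 1 = q - 2 by ring] at this
      exact this.hasDerivWithinAt
    · rw [Real.norm_eq_abs, abs_of_nonneg (mul_nonneg (by linarith) (Real.rpow_nonneg hr.1 _))]
      exact mul_le_mul_of_nonneg_left (Real.rpow_le_rpow hr.1 hr.2 (by linarith)) (by linarith)
  have hopp : ∀ u v : ℝ, 0 ≤ u → v ≤ 0 → |u| ≤ M → |v| ≤ M →
      |(|u| ^ (q - 2) * u) - |v| ^ (q - 2) * v| ≤ (q - 1) * M ^ (q - 2) * |u - v| := by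
    intro u v hu hv huM hvM
    have hMq : 0 ≤ M ^ (q - 2) := Real.rpow_nonneg ((abs_nonneg _).trans huM) _
    have e₁ : |u| ^ (q - 2) * u ≤ M ^ (q - 2) * u :=
      mul_le_mul_of_nonneg_right (Real.rpow_le_rpow (abs_nonneg _) huM (by linarith)) hu
    have e₂ : |v| ^ (q - 2) * (-v) ≤ M ^ (q - 2) * (-v) :=
      mul_le_mul_of_nonneg_right (Real.rpow_le_rpow (abs_nonneg _) hvM (by linarith))
        (by linarith)
    have e₃ : 0 ≤ |u| ^ (q - 2) * u := by positivity
    have e₄ : 0 ≤ |v| ^ (q - 2) * (-v) := mul_nonneg (by positivity) (by linarith)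
    have e₅ : 0 ≤ M ^ (q - 2) * (u - v) := mul_nonneg hMq (by linarith)
    rw [abs_of_nonneg (by linarith), abs_of_nonneg (by linarith : 0 ≤ u - v)]
    nlinarith
  rcases le_total 0 u with h1 | h1 <;> rcases le_total 0 v with h2 | h2
  · exact hpos u v h1 h2 ((le_abs_self u).trans hu) ((le_abs_self v).trans hv)
  · exact hopp u v h1 h2 hu hv
  · rw [abs_sub_comm, abs_sub_comm u]
    exact hopp v u h2 h1 hv hu
  · have := hpos (-u) (-v) (by linarith) (by linarith) ((neg_le_abs u).trans hu)
      ((neg_le_abs v).trans hv)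
    rw [abs_neg, abs_neg] at this
    rw [abs_sub_comm, abs_sub_comm u]
    convert this using 2 <;> ring_nf

/-- Second order estimate for `a ↦ |a| ^ q`, `q ≥ 2`. -/
theorem abs_rpow_taylor_le {q : ℝ} (hq : 2 ≤ q) (a b : ℝ) :
    |(|a + b| ^ q) - |a| ^ q - q * (|a| ^ (q - 2) * a) * b| ≤
      q * (q - 1) * (|a| + |b|) ^ (q - 2) * b ^ 2 := by
  refine abs_sub_sub_mul_le_of_hasDerivAt (f := fun r => |r| ^ q)
    (f' := fun r => q * (|r| ^ (q - 2) * r)) (fun r => ?_) (fun v hv => ?_)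
  · simpa only [mul_assoc] using hasDerivAt_abs_rpow r (p := q) (by linarith)
  · have hv' : |v| ≤ |a| + |b| := by
      have := abs_add_le a (v - a)
      rw [add_sub_cancel] at this
      linarith
    rw [← mul_sub, abs_mul, abs_of_nonneg (by linarith : 0 ≤ q)]
    have h := abs_sub_abs_rpow_mul_self_le hq hv' (le_add_of_nonneg_right (abs_nonneg b))
    have hM : 0 ≤ (q - 1) * (|a| + |b|) ^ (q - 2) :=
      mul_nonneg (by linarith) (by positivity)
    calc _ ≤ q * ((q - 1) * (|a| + |b|) ^ (q - 2) * |b|) := by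
          refine mul_le_mul_of_nonneg_left (h.trans ?_) (by linarith)
          exact mul_le_mul_of_nonneg_left hv hM
      _ = _ := by ring

theorem rpow_sub_two_mul_mul {X q : ℝ} (hX : 0 ≤ X) (hq : 2 ≤ q) :
    X ^ (q - 2) * X * X = X ^ q := by
  rw [mul_assoc, ← sq, ← Real.rpow_natCast X 2,
    ← Real.rpow_add_of_nonneg hX (by linarith) (by norm_num)]
  norm_num

/-- Integrability against the Sobolev weight of functions vanishing on the diagonal at order
`β q`. -/
theorem integrable_div_abs_sub_rpow {γ β q C : ℝ} (hγ : 0 < γ) (hq : 2 ≤ q)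
    (hβ : 1 < (β - γ) * q) (hC : 0 ≤ C) {num : unitInterval × unitInterval → ℝ}
    (hnum : Measurable num) (h : ∀ x, |num x| ≤ C * (|(x.1 : ℝ) - x.2| ^ β) ^ q) :
    Integrable (fun x => num x / |(x.1 : ℝ) - x.2| ^ (q * γ + 2)) ∧
    |∫ x, num x / |(x.1 : ℝ) - x.2| ^ (q * γ + 2)| ≤
      C * ∫ x : unitInterval × unitInterval, |(x.1 : ℝ) - x.2| ^ ((β - γ) * q - 2) := by
  have hk := integrable_abs_sub_rpow (s := (β - γ) * q - 2) (by linarith)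
  have hb : ∀ x, ‖num x / |(x.1 : ℝ) - x.2| ^ (q * γ + 2)‖ ≤
      C * |(x.1 : ℝ) - x.2| ^ ((β - γ) * q - 2) := by
    intro x
    -- On the diagonal the weight is `0` and the quotient is `0` by convention, so the bound holds
    -- at every point.
    rcases (abs_nonneg ((x.1 : ℝ) - x.2)).eq_or_lt with h0 | h0
    · rw [← h0, Real.zero_rpow (by positivity), div_zero, norm_zero]
      positivity
    · rw [norm_div, Real.norm_eq_abs, Real.norm_eq_abs, abs_of_pos (Real.rpow_pos_of_pos h0 _),
        div_le_iff₀ (Real.rpow_pos_of_pos h0 _), mul_assoc, ← Real.rpow_add h0]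
      refine (h x).trans_eq ?_
      rw [← Real.rpow_mul h0.le]
      congr 2
      ring
  have hm : Measurable fun x : unitInterval × unitInterval =>
      num x / |(x.1 : ℝ) - x.2| ^ (q * γ + 2) := hnum.div (by fun_prop)
  refine ⟨(hk.const_mul C).mono' hm.aestronglyMeasurable (Filter.Eventually.of_forall hb), ?_⟩
  rw [← integral_const_mul]
  exact norm_integral_le_of_norm_le (hk.const_mul C) (Filter.Eventually.of_forall hb)

section Functional

variable {γ p : ℝ} {β : ℝ≥0}

theorem HolderSpace.integrable_sobolevIntegrand (hγ : 0 < γ) (hp : 1 ≤ p)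
    (hβ : 1 < (β - γ) * (2 * p)) (f : HolderSpace β) : Integrable (sobolevIntegrand γ p f) := by
  have := f.continuous_coe
  refine (integrable_div_abs_sub_rpow (C := ‖f‖ ^ (2 * p)) (β := β) hγ (by linarith) hβ
    (by positivity) (num := fun x => |f x.1 - f x.2| ^ (2 * p)) (by fun_prop) fun x => ?_).1
  rw [abs_of_nonneg (by positivity), ← Real.mul_rpow (norm_nonneg _) (by positivity)]
  exact Real.rpow_le_rpow (abs_nonneg _) (f.abs_sub_le _ _) (by linarith)

/-- The numerator is homogeneous of degree `2p - 1` in `f` and `1` in `k`, so it vanishes at the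
diagonal to order `2pβ`. The bound is linear in `‖k‖`, which makes the candidate derivative
continuous. -/
theorem HolderSpace.sobolevDerivIntegrand_bound (hγ : 0 < γ) (hp : 1 ≤ p)
    (hβ : 1 < (β - γ) * (2 * p)) (f k : HolderSpace β) :
    Integrable (sobolevDerivIntegrand γ p f k) ∧
    |∫ x, sobolevDerivIntegrand γ p f k x| ≤ ‖f‖ ^ (2 * p - 2) * ‖f‖ * ‖k‖ *
      ∫ x : unitInterval × unitInterval, |(x.1 : ℝ) - x.2| ^ ((β - γ) * (2 * p) - 2) := by
  have hf := f.continuous_coe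
  have hk := k.continuous_coe
  refine integrable_div_abs_sub_rpow (C := ‖f‖ ^ (2 * p - 2) * ‖f‖ * ‖k‖) (β := β) hγ
    (by linarith) hβ (by positivity)
    (num := fun x => |f x.1 - f x.2| ^ (2 * p - 2) * (f x.1 - f x.2) * (k x.1 - k x.2))
    (by fun_prop) fun x => ?_
  have hX : 0 ≤ |(x.1 : ℝ) - x.2| ^ (β : ℝ) := by positivity
  have h1 := f.abs_sub_le x.2 x.1
  have h2 := k.abs_sub_le x.2 x.1
  rw [abs_mul, abs_mul, abs_of_nonneg (by positivity : 0 ≤ |f x.1 - f x.2| ^ (2 * p - 2)),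
    ← rpow_sub_two_mul_mul hX (by linarith : 2 ≤ 2 * p)]
  have h3 : |f x.1 - f x.2| ^ (2 * p - 2) ≤
      ‖f‖ ^ (2 * p - 2) * (|(x.1 : ℝ) - x.2| ^ (β : ℝ)) ^ (2 * p - 2) := by
    rw [← Real.mul_rpow (norm_nonneg _) hX]
    exact Real.rpow_le_rpow (abs_nonneg _) h1 (by linarith)
  calc _ ≤ ‖f‖ ^ (2 * p - 2) * (|(x.1 : ℝ) - x.2| ^ (β : ℝ)) ^ (2 * p - 2) *
        (‖f‖ * |(x.1 : ℝ) - x.2| ^ (β : ℝ)) * (‖k‖ * |(x.1 : ℝ) - x.2| ^ (β : ℝ)) := by gcongr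
    _ = _ := by ring

/-- The functional `f ↦ ‖f‖_{γ,p} ^ (2p)` is Fréchet differentiable on `C^β`. -/
theorem exists_hasFDerivAt_integral_sobolevIntegrand (hγ : 0 < γ) (hp : 1 ≤ p)
    (hβ : 1 < (β - γ) * (2 * p)) (f : HolderSpace β) :
    ∃ D : HolderSpace β →L[ℝ] ℝ,
      HasFDerivAt (fun f : HolderSpace β => ∫ x, sobolevIntegrand γ p f x) D f ∧
      ∀ k, D k = 2 * p * ∫ x, sobolevDerivIntegrand γ p f k x := by
  have hq : 2 ≤ 2 * p := by linarith
  set K := ∫ x : unitInterval × unitInterval, |(x.1 : ℝ) - x.2| ^ ((β - γ) * (2 * p) - 2) with hK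
  have hK0 : 0 ≤ K := integral_nonneg fun x => by positivity
  have hint := fun k => (f.sobolevDerivIntegrand_bound hγ hp hβ k).1
  let L : HolderSpace β →ₗ[ℝ] ℝ :=
    { toFun := fun k => 2 * p * ∫ x, sobolevDerivIntegrand γ p f k x
      map_add' := fun k k' => by
        rw [← mul_add, ← integral_add (hint k) (hint k')]
        congr 1
        refine integral_congr_ae (Filter.Eventually.of_forall fun x => ?_)
        simp only [sobolevDerivIntegrand, HolderSpace.add_apply]
        ring
      map_smul' := fun c k => by
        rw [RingHom.id_apply, smul_eq_mul, mul_left_comm, ← integral_const_mul c]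
        congr 1
        refine integral_congr_ae (Filter.Eventually.of_forall fun x => ?_)
        simp only [sobolevDerivIntegrand, HolderSpace.smul_apply]
        ring }
  refine ⟨L.mkContinuous (2 * p * (‖f‖ ^ (2 * p - 2) * ‖f‖ * K)) fun k => ?_, ?_, fun k => rfl⟩
  · change |2 * p * ∫ x, sobolevDerivIntegrand γ p f k x| ≤ _
    rw [abs_mul, abs_of_nonneg (by linarith)]
    have := (f.sobolevDerivIntegrand_bound hγ hp hβ k).2
    calc _ ≤ 2 * p * (‖f‖ ^ (2 * p - 2) * ‖f‖ * ‖k‖ * K) := by gcongr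
      _ = _ := by ring
  · refine hasFDerivAt_of_norm_sub_le_sq
      (K := 2 * p * (2 * p - 1) * (‖f‖ + 1) ^ (2 * p - 2) * K) fun k hk => ?_
    have hfc := f.continuous_coe
    have hkc := k.continuous_coe
    -- Pointwise first order Taylor remainder of `|·| ^ (2p)`; linearity of the integral makes its
    -- weighted integral the remainder of the functional.
    set num : unitInterval × unitInterval → ℝ := fun x =>
      |(f x.1 - f x.2) + (k x.1 - k x.2)| ^ (2 * p) - |f x.1 - f x.2| ^ (2 * p) -
        2 * p * (|f x.1 - f x.2| ^ (2 * p - 2) * (f x.1 - f x.2)) * (k x.1 - k x.2) with hnum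
    have hval : (∫ x, sobolevIntegrand γ p (f + k : HolderSpace β) x) -
        (∫ x, sobolevIntegrand γ p f x) - 2 * p * ∫ x, sobolevDerivIntegrand γ p f k x =
        ∫ x, num x / |(x.1 : ℝ) - x.2| ^ (2 * p * γ + 2) := by
      have hI := (f + k).integrable_sobolevIntegrand hγ hp hβ
      have hI' := f.integrable_sobolevIntegrand hγ hp hβ
      rw [← integral_const_mul, ← integral_sub hI hI']
      refine (integral_sub (hI.sub hI') ((hint k).const_mul _)).symm.trans ?_
      refine integral_congr_ae (Filter.Eventually.of_forall fun x => ?_)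
      simp only [Pi.sub_apply, sobolevIntegrand, sobolevDerivIntegrand, HolderSpace.add_apply, hnum]
      rw [show f x.1 + k x.1 - (f x.2 + k x.2) = (f x.1 - f x.2) + (k x.1 - k x.2) by ring]
      ring
    change ‖(∫ x, sobolevIntegrand γ p (f + k : HolderSpace β) x) -
        (∫ x, sobolevIntegrand γ p f x) - 2 * p * ∫ x, sobolevDerivIntegrand γ p f k x‖ ≤ _
    have hp0 : 0 ≤ 2 * p * (2 * p - 1) := mul_nonneg (by linarith) (by linarith)
    rw [hval]
    refine ((integrable_div_abs_sub_rpow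
      (C := 2 * p * (2 * p - 1) * (‖f‖ + 1) ^ (2 * p - 2) * ‖k‖ ^ 2) (β := β) (num := num) hγ
      hq hβ (by positivity) (by fun_prop) fun x => ?_).2).trans_eq (by rw [← hK]; ring)
    have hX : 0 ≤ |(x.1 : ℝ) - x.2| ^ (β : ℝ) := by positivity
    have h1 := f.abs_sub_le x.2 x.1
    have h2 := k.abs_sub_le x.2 x.1
    have h3 : (|f x.1 - f x.2| + |k x.1 - k x.2|) ^ (2 * p - 2) ≤
        (‖f‖ + 1) ^ (2 * p - 2) * (|(x.1 : ℝ) - x.2| ^ (β : ℝ)) ^ (2 * p - 2) := by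
      rw [← Real.mul_rpow (by positivity) hX]
      refine Real.rpow_le_rpow (by positivity) ?_ (by linarith)
      -- Here `‖k‖ ≤ 1` removes `k` from the constant, leaving only the factor `‖k‖ ^ 2`.
      have : ‖k‖ * |(x.1 : ℝ) - x.2| ^ (β : ℝ) ≤ 1 * |(x.1 : ℝ) - x.2| ^ (β : ℝ) := by gcongr
      linarith
    refine (abs_rpow_taylor_le hq _ _).trans ?_
    rw [← rpow_sub_two_mul_mul hX hq, ← sq_abs (k x.1 - k x.2)]
    calc _ ≤ 2 * p * (2 * p - 1) *
          ((‖f‖ + 1) ^ (2 * p - 2) * (|(x.1 : ℝ) - x.2| ^ (β : ℝ)) ^ (2 * p - 2)) *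
          (‖k‖ * |(x.1 : ℝ) - x.2| ^ (β : ℝ)) ^ 2 := by gcongr
      _ = _ := by ring

theorem sobolevNorm_rpow (hp : 0 < p) (f : unitInterval → ℝ) :
    sobolevNorm γ p f ^ (2 * p) = ∫ x, sobolevIntegrand γ p f x := by
  rw [sobolevNorm, one_div, Real.rpow_inv_rpow _ (by positivity)]
  exact integral_nonneg fun x => div_nonneg (by positivity) (by positivity)

/-- Smoothness is only given on `(0, ∞)`, but the Sobolev functional can vanish; at `0` the function
is locally `1` because `M > 0`. -/
theorem IsCutoff.hasDerivAt {M : ℝ} {φ : ℝ → ℝ} (hφ : IsCutoff M φ) (hM : 0 < M) {r : ℝ}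
    (hr : 0 ≤ r) : HasDerivAt φ (deriv φ r) r := by
  refine DifferentiableAt.hasDerivAt ?_
  rcases hr.eq_or_lt with rfl | hr
  · have : φ =ᶠ[nhds 0] fun _ => 1 := by
      filter_upwards [Iio_mem_nhds hM] with r hr using hφ.eq_one r hr
    exact this.differentiableAt_iff.mpr (differentiableAt_const _)
  · exact (hφ.contDiffOn.differentiableOn (by simp)).differentiableAt (Ioi_mem_nhds hr)

theorem exists_hasFDerivAt_cutoffG {M : ℝ} {φ : ℝ → ℝ} (hφ : IsCutoff M φ) (hM : 0 < M)
    (hγ : 0 < γ) (hp : 1 ≤ p) (hβ : 1 < (β - γ) * (2 * p)) (f : HolderSpace β) :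
    ∃ D : HolderSpace β →L[ℝ] ℝ,
      HasFDerivAt (fun f : HolderSpace β => cutoffG φ γ p f) D f ∧
      ∀ k : HolderSpace β, D k = 2 * p * deriv φ (sobolevNorm γ p f ^ (2 * p)) *
        ∫ x, sobolevDerivIntegrand γ p f k x := by
  obtain ⟨D, hD, hDk⟩ := exists_hasFDerivAt_integral_sobolevIntegrand hγ hp hβ f
  have hp0 : 0 < p := by linarith
  have hr : 0 ≤ ∫ x, sobolevIntegrand γ p f x :=
    integral_nonneg fun x => div_nonneg (by positivity) (by positivity)
  refine ⟨deriv φ (sobolevNorm γ p f ^ (2 * p)) • D, ?_, fun k => ?_⟩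
  · simp only [cutoffG, sobolevNorm_rpow hp0]
    exact (hφ.hasDerivAt hM hr).comp_hasFDerivAt f hD
  · rw [smul_apply, hDk, smul_eq_mul]
    ring

end Functional

/-! ### Assembly of the theorem -/

theorem proposition3p1 (γ κ ε : ℝ≥0) (p M : ℝ) (φ σ : ℝ → ℝ)
    (hγ0 : 0 < γ) (hγ1 : γ < 1) (hκ0 : 0 < κ) (hκ1 : κ < 1) (hγκ : 1 < γ + κ)
    (hp : 1 ≤ p) (hε : 1 / (2 * p) < (ε : ℝ)) (hM : 0 < M) (hφ : IsCutoff M φ)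
    (hσ : ContDiff ℝ 4 σ) (hσb : ∀ n : ℕ, n ≤ 4 → ∃ C : ℝ, ∀ y, |iteratedDeriv n σ y| ≤ C)
    (x : HolderSpace (γ + ε)) :
    -- `G_M` is well defined and Fréchet differentiable on `C^{γ+ε}`, with the explicit derivative
    (∀ y : HolderSpace (γ + ε),
      Integrable (sobolevIntegrand γ p y) ∧
      (∀ k : HolderSpace (γ + ε), Integrable (sobolevDerivIntegrand γ p y k)) ∧
      ∃ DG : HolderSpace (γ + ε) →L[ℝ] ℝ,
        HasFDerivAt (fun f : HolderSpace (γ + ε) => cutoffG φ γ p f) DG y ∧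
        ∀ k : HolderSpace (γ + ε), DG k =
          2 * p * deriv φ (sobolevNorm γ p y ^ (2 * p)) *
            ∫ q : unitInterval × unitInterval, sobolevDerivIntegrand γ p y k q) ∧
    -- all the integrals below exist
    (∀ (c : ℝ) (f : HolderSpace (γ + ε)) (z g : HolderSpace κ),
      (∀ u : unitInterval, YoungIntegrable (fun ξ => c * σ (z ξ)) f u 1) ∧
      YoungIntegrable (fun ξ => ξ * (c * σ (z ξ))) f 0 1 ∧
      (∀ u : unitInterval, YoungIntegrable (fun ξ => c * deriv σ (z ξ) * g ξ) f u 1) ∧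
      YoungIntegrable (fun ξ => ξ * (c * deriv σ (z ξ) * g ξ)) f 0 1 ∧
      Integrable (fun u : unitInterval => youngIntegral (fun ξ => c * σ (z ξ)) f u 1) ∧
      Integrable (fun u : unitInterval => youngIntegral (fun ξ => c * deriv σ (z ξ) * g ξ) f u 1)) ∧
    -- `F(h, z) = z - Γ_{x+h}(z)` takes values in `C^κ`, is continuous, and is Fréchet
    -- differentiable in each variable with the explicit derivatives
    ∃ F : HolderSpace (γ + ε) → HolderSpace κ → HolderSpace κ,
      (∀ h z t, F h z t = z t - ellipticMap φ γ p σ (x + h : HolderSpace (γ + ε)) z t) ∧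
      Continuous (fun q : HolderSpace (γ + ε) × HolderSpace κ => F q.1 q.2) ∧
      ∀ (h : HolderSpace (γ + ε)) (z : HolderSpace κ),
        (∃ D₁ : HolderSpace (γ + ε) →L[ℝ] HolderSpace κ,
          HasFDerivAt (fun h' => F h' z) D₁ h ∧
          ∀ (k : HolderSpace (γ + ε)) (t : unitInterval), D₁ k t =
            -(∫ u in Iic t,
                (youngIntegral
                    (fun ξ => cutoffSigma φ γ p σ (x + h : HolderSpace (γ + ε)) (z ξ)) k u 1 +
                  youngIntegral
                    (fun ξ => fderiv ℝ (fun f : HolderSpace (γ + ε) => cutoffG φ γ p f) (x + h) k *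
                      σ (z ξ)) (x + h : HolderSpace (γ + ε)) u 1)) +
              t * (youngIntegral
                    (fun ξ => ξ * cutoffSigma φ γ p σ (x + h : HolderSpace (γ + ε)) (z ξ)) k 0 1 +
                  youngIntegral
                    (fun ξ => ξ *
                      (fderiv ℝ (fun f : HolderSpace (γ + ε) => cutoffG φ γ p f) (x + h) k *
                        σ (z ξ))) (x + h : HolderSpace (γ + ε)) 0 1)) ∧
        (∃ D₂ : HolderSpace κ →L[ℝ] HolderSpace κ,
          HasFDerivAt (fun z' => F h z') D₂ z ∧
          ∀ (g : HolderSpace κ) (t : unitInterval), D₂ g t =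
            g t -
              (∫ u in Iic t,
                youngIntegral
                  (fun ξ => cutoffG φ γ p (x + h : HolderSpace (γ + ε)) * deriv σ (z ξ) * g ξ)
                  (x + h : HolderSpace (γ + ε)) u 1) +
              t * youngIntegral
                (fun ξ => ξ *
                  (cutoffG φ γ p (x + h : HolderSpace (γ + ε)) * deriv σ (z ξ) * g ξ))
                (x + h : HolderSpace (γ + ε)) 0 1) := by
  have hκ' : (0 : ℝ) < κ := NNReal.coe_pos.mpr hκ0
  have hγ' : (0 : ℝ) < γ := NNReal.coe_pos.mpr hγ0
  have hγα : (γ : ℝ) ≤ (γ + ε : ℝ≥0) := by push_cast; linarith [ε.coe_nonneg]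
  have hθ : 1 < (κ : ℝ) + γ := by rw [add_comm]; exact_mod_cast hγκ
  -- This is `2pε > 1`, the integrability threshold of the kernel.
  have hβ : 1 < (((γ + ε : ℝ≥0) : ℝ) - γ) * (2 * p) := by
    rw [NNReal.coe_add, add_sub_cancel_left]
    exact (div_lt_iff₀ (by linarith)).mp hε
  have hder : ∀ n : ℕ, n < 4 → ∀ y,
      HasDerivAt (iteratedDeriv n σ) (iteratedDeriv (n + 1) σ y) y := by
    intro n hn y
    rw [iteratedDeriv_succ]
    exact (hσ.differentiable_iteratedDeriv n (by exact_mod_cast hn)).differentiableAt.hasDerivAt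
  have h₀ : ∀ y, HasDerivAt σ (deriv σ y) y := fun y => by
    simpa only [iteratedDeriv_zero, zero_add, iteratedDeriv_one] using hder 0 (by norm_num) y
  have h₁ : ∀ y, HasDerivAt (deriv σ) (iteratedDeriv 2 σ y) y := fun y => by
    simpa only [iteratedDeriv_one] using hder 1 (by norm_num) y
  obtain ⟨C₁, hC₁⟩ := hσb 1 (by norm_num)
  obtain ⟨C₂, hC₂⟩ := hσb 2 (by norm_num)
  obtain ⟨C₃, hC₃⟩ := hσb 3 (by norm_num)
  rw [iteratedDeriv_one] at hC₁
  obtain ⟨S, hS, hSd⟩ := HolderSpace.exists_comp_hasFDerivAt hκ0 h₀ h₁ (hder 2 (by norm_num))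
    hC₁ hC₂ hC₃
  choose DS hDS hSDS using hSd
  obtain ⟨T, hT⟩ := exists_youngDrift_bilinear hκ0 hκ1.le hγ' hγα hθ
  have hG := fun y : HolderSpace (γ + ε) => exists_hasFDerivAt_cutoffG (p := p) hφ hM hγ' hp hβ y
  choose DG hDG hDGk using hG
  have hSc : ∀ (c : ℝ) (z : HolderSpace κ),
      (fun ξ => c * σ (z ξ)) = (c • S z : HolderSpace κ) := fun c z => by
    ext ξ; rw [HolderSpace.smul_apply, hS]
  have hDSc : ∀ (c : ℝ) (z g : HolderSpace κ),
      (fun ξ => c * deriv σ (z ξ) * g ξ) = (c • DS z g : HolderSpace κ) := fun c z g => by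
    ext ξ; rw [HolderSpace.smul_apply, hDS, mul_assoc]
  -- The cutoff is constant in `ξ`, so linearity of `T` in the integrand extracts it from both
  -- integrals.
  have hell : ∀ (f : HolderSpace (γ + ε)) (z : HolderSpace κ) t,
      ellipticMap φ γ p σ f z t = -(cutoffG φ γ p f * T (S z) f t) := by
    intro f z t
    have := hT (cutoffG φ γ p f • S z) f t
    rw [map_smul, smul_apply, HolderSpace.smul_apply] at this
    rw [this, ← hSc, youngDrift, ellipticMap]
    simp only [cutoffSigma]
    ring
  have hyi := fun (w : HolderSpace κ) (f : HolderSpace (γ + ε)) (u : unitInterval) =>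
    w.hasYoungIntegral hκ0 hγ' hγα hθ f (unitInterval.le_one' (t := u))
  have hyi' := fun (w : HolderSpace κ) (f : HolderSpace (γ + ε)) =>
    w.hasYoungIntegral_coe_mul hκ0 hκ1.le hγ' hγα hθ f (unitInterval.le_one' (t := 0))
  have hyint := fun (w : HolderSpace κ) (f : HolderSpace (γ + ε)) =>
    w.integrable_youngIntegral hκ0 hγ' hγα hθ f
  refine ⟨fun y => ⟨y.integrable_sobolevIntegrand hγ' hp hβ,
    fun k => (y.sobolevDerivIntegrand_bound hγ' hp hβ k).1, DG y, hDG y, hDGk y⟩, ?_, ?_⟩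
  · intro c f z g
    have hc := congrFun (hSc c z)
    have hd := congrFun (hDSc c z g)
    simp only [hc, hd]
    exact ⟨fun u => ⟨_, hyi _ f u⟩, ⟨_, hyi' _ f⟩, fun u => ⟨_, hyi _ f u⟩, ⟨_, hyi' _ f⟩,
      hyint _ f, hyint _ f⟩
  refine ⟨fun h z => z + cutoffG φ γ p (x + h : HolderSpace (γ + ε)) • T (S z) (x + h),
    fun h z t => ?_, ?_, fun h z => ⟨?_, ?_⟩⟩
  · rw [hell, HolderSpace.add_apply, HolderSpace.smul_apply, sub_neg_eq_add]
  · have hGc : Continuous fun f : HolderSpace (γ + ε) => cutoffG φ γ p f :=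
      continuous_iff_continuousAt.mpr fun f => (hDG f).continuousAt
    have hScont : Continuous S := continuous_iff_continuousAt.mpr fun z => (hSDS z).continuousAt
    have hx : Continuous fun q : HolderSpace (γ + ε) × HolderSpace κ => x + q.1 :=
      continuous_const.add continuous_fst
    exact continuous_snd.add ((hGc.comp hx).smul
      ((T.continuous.comp (hScont.comp continuous_snd)).clm_apply hx))
  · have hx : HasFDerivAt (fun h' : HolderSpace (γ + ε) => x + h')
        (ContinuousLinearMap.id ℝ (HolderSpace (γ + ε))) h := (hasFDerivAt_id h).const_add x
    have h1 := (hDG (x + h)).comp h hx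
    have h2 := (T (S z)).hasFDerivAt.comp h hx
    refine ⟨_, (h1.smul h2).const_add z, fun k t => ?_⟩
    -- The product rule yields scalars times values of `T`. Moving each scalar back into the
    -- integrand gives the integrals of the stated formula: `e₁` differentiates the driver, `e₂` the
    -- cutoff.
    have e₁ := hT (cutoffG φ γ p (x + h : HolderSpace (γ + ε)) • S z) k t
    have e₂ := hT (DG (x + h) k • S z) (x + h) t
    rw [map_smul, smul_apply, HolderSpace.smul_apply, youngDrift] at e₁ e₂
    simp only [cutoffSigma, (hDG (x + h)).fderiv]
    simp only [congrFun (hSc _ z)]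
    rw [integral_add (hyint _ k).integrableOn (hyint _ (x + h)).integrableOn]
    change cutoffG φ γ p (x + h : HolderSpace (γ + ε)) * T (S z) k t +
      DG (x + h) k * T (S z) (x + h) t = _
    rw [e₁, e₂]
    ring
  -- For fixed `h` the driver and the cutoff are frozen, so only the chain rule through `S` is
  -- needed.
  · have h1 := (T.flip (x + h)).hasFDerivAt.comp z (hSDS z)
    refine ⟨_, (hasFDerivAt_id z).add
      (h1.const_smul (cutoffG φ γ p (x + h : HolderSpace (γ + ε)))), fun g t => ?_⟩
    have e := hT (cutoffG φ γ p (x + h : HolderSpace (γ + ε)) • DS z g) (x + h) t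
    rw [map_smul, smul_apply, HolderSpace.smul_apply, youngDrift] at e
    simp only [congrFun (hDSc _ z g)]
    change g t + cutoffG φ γ p (x + h : HolderSpace (γ + ε)) * T (DS z g) (x + h) t = _
    rw [e]
    ring
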